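/- Let $n\ge 1$, let $x=(x_1,\dots,x_n)$ and $a=(a_0,a_1,a_2,\dots)$ be families of parameters (arbitrary elements of a commutative ring), let $\mu=(\mu_1\ge\dots\ge\mu_n\ge 0)$ be a partition of length at most $n$, let $\delta=(n,n-1,\dots,1)$ and $\lambda=\mu+\delta$. Then $\lambda$ is a strict partition of length $n$, and $$Q_\lambda(x|a)=\prod_{1\le i\le n}2x_i\ \prod_{1\le i<j\le n}(x_i+x_j)\ s_\mu(x|a).$$ Here the factorial Schur function is $$s_\mu(x|a)=\sum_{T}\ \prod_{(i,j)\in F^\mu}\bigl(x_{T_{ij}}+a_{T_{ij}+j-i}\bigr),$$ summed over all semistandard tableaux $T$ of shape $\mu$ with entries in $\{1,\dots,n\}$ (rows weakly increasing, columns strictly increasing), where $F^\mu=\{(i,j):1\le i\le n,\ 1\le j\le\mu_i\}$. The factorial Schur $Q$-function $Q_\lambda(x|a)$ is the specialisation $y=x$ of $$Q_\lambda(x;y|a)=\sum_{P}\ \prod_{\substack{(i,j)\in SF^\lambda\\ P_{ij}=k}}(x_k+a_{j-i})\ \prod_{\substack{(i,j)\in SF^\lambda\\ P_{ij}=k'}}(y_k-a_{j-i}),$$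 where $SF^\lambda=\{(i,j):1\le i\le n,\ i\le j\le i+\lambda_i-1\}$ is the shifted diagram and $P$ runs over all primed shifted tableaux of shape $\lambda$, that is, fillings of $SF^\lambda$ by letters of $1'<1<2'<2<\dots<n'<n$ such that entries weakly increase along rows and down columns, each primed letter occurs at most once in every row, and each unprimed letter occurs at most once in every column. (Neither side depends on $a_0$.) -/

import Mathlib

/-- The staircase `δ = (n, n-1, …, 1)`; the index `i : Fin n` stands for the part number `i + 1`. -/
def staircase (n : ℕ) : Fin n → ℕ := fun i => n - i

/-- The Young diagram `F^μ` of a partition `μ = (μ₁ ≥ … ≥ μₙ ≥ 0)`. Its boxes are the pairs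
`(i, j)` of natural numbers with `i < n` and `j < μ i` (rows and columns are counted from `0`). -/
def partitionDiagram {n : ℕ} (μ : Fin n → ℕ) (hμ : Antitone μ) : YoungDiagram :=
  YoungDiagram.ofRowLens (List.ofFn μ) hμ.sortedGE_ofFn

/-- The boxes of `partitionDiagram μ hμ`. -/
theorem mem_partitionDiagram {n : ℕ} {μ : Fin n → ℕ} {hμ : Antitone μ} {c : ℕ × ℕ} :
    c ∈ partitionDiagram μ hμ ↔ ∃ h : c.1 < n, c.2 < μ ⟨c.1, h⟩ := by
  simp [partitionDiagram, YoungDiagram.mem_ofRowLens]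

/-- Semistandard tableaux of shape `D` with entries in an alphabet of `n` letters. Mathlib's
tableaux have natural number entries starting at `0`, so the letter `k ∈ {1, …, n}` is
represented by `k - 1`. -/
abbrev BoundedTableau (D : YoungDiagram) (n : ℕ) : Type :=
  {T : SemistandardYoungTableau D // ∀ c ∈ D.cells, T c.1 c.2 < n}

/-- A tableau with bounded entries is determined by its entries in the finitely many boxes. -/
theorem BoundedTableau.injective_entries (D : YoungDiagram) (n : ℕ) :
    Function.Injective
      (fun (T : BoundedTableau D n) (c : D.cells) => (⟨T.1 c.1.1 c.1.2, T.2 c.1 c.2⟩ : Fin n)) := by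
  intro T T' h
  apply Subtype.ext
  apply SemistandardYoungTableau.ext
  intro i j
  by_cases hc : (i, j) ∈ D
  · have h1 := congrFun h ⟨(i, j), (YoungDiagram.mem_cells _).2 hc⟩
    simpa using h1
  · rw [T.1.zeros hc, T'.1.zeros hc]

noncomputable instance BoundedTableau.fintype (D : YoungDiagram) (n : ℕ) :
    Fintype (BoundedTableau D n) :=
  Fintype.ofInjective _ (BoundedTableau.injective_entries D n)

/-- The factorial Schur function
`s_D(x|a) = ∑_T ∏_{(i,j) ∈ D} (x_{T i j} + a_{T i j + j - i})`,
the sum being over semistandard tableaux with entries in `{1, …, n}`. Since `T i j` below is one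
less than the entry in `{1, …, n}`, the index of `a` is `(T i j + 1) + j - i`; column strictness
gives `i ≤ T i j`, so the subtraction is never truncated and the index is at least `1`. -/
noncomputable def factorialSchur {R : Type*} [CommRing R] {n : ℕ} (D : YoungDiagram)
    (x : Fin n → R) (a : ℕ → R) : R :=
  ∑ T : BoundedTableau D n, ∏ c : D.cells,
    (x ⟨T.1 c.1.1 c.1.2, T.2 c.1 c.2⟩ + a (T.1 c.1.1 c.1.2 + 1 + c.1.2 - c.1.1))

/-- The shifted diagram `SF^lam`: in row `i` (counted from `0`) there are `lam i` boxes `(i, j)`,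
in the columns `j = i, i + 1, …, i + lam i - 1`. -/
def shiftedDiagram {n : ℕ} (lam : Fin n → ℕ) : Finset (ℕ × ℕ) :=
  Finset.univ.biUnion fun i : Fin n =>
    (Finset.Ico (i : ℕ) (i + lam i)).image fun j => ((i : ℕ), j)

/-- The boxes of `shiftedDiagram lam`. -/
theorem mem_shiftedDiagram {n : ℕ} {lam : Fin n → ℕ} {c : ℕ × ℕ} :
    c ∈ shiftedDiagram lam ↔ ∃ h : c.1 < n, c.1 ≤ c.2 ∧ c.2 < c.1 + lam ⟨c.1, h⟩ := by
  obtain ⟨i, j⟩ := c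
  simp only [shiftedDiagram, Finset.mem_biUnion, Finset.mem_univ, true_and, Finset.mem_image,
    Finset.mem_Ico, Prod.mk.injEq]
  constructor
  · rintro ⟨k, l, hl, rfl, rfl⟩
    exact ⟨k.2, hl⟩
  · rintro ⟨h, hl⟩
    exact ⟨⟨i, h⟩, j, hl, rfl, rfl⟩

/-- The totally ordered alphabet `1' < 1 < 2' < 2 < ⋯ < n' < n`. The pair `(k, false)` is the
primed letter and `(k, true)` the unprimed letter with absolute value `k` (again counted
from `0`), in lexicographic order. -/
abbrev PrimedLetter (n : ℕ) : Type := Fin n ×ₗ Bool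

/-- The absolute value of a letter: `|k| = |k'| = k`. -/
def PrimedLetter.abs {n : ℕ} (p : PrimedLetter n) : Fin n := (ofLex p).1

/-- Whether a letter is primed. -/
def PrimedLetter.IsPrimed {n : ℕ} (p : PrimedLetter n) : Prop := (ofLex p).2 = false

instance PrimedLetter.decidableIsPrimed {n : ℕ} (p : PrimedLetter n) : Decidable p.IsPrimed :=
  inferInstanceAs (Decidable ((ofLex p).2 = false))

/-- The conditions on a filling of the shifted diagram to be a primed shifted tableau (primed
letters are allowed on the main diagonal). -/
structure IsPrimedShiftedTableau {n : ℕ} {lam : Fin n → ℕ}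
    (p : shiftedDiagram lam → PrimedLetter n) : Prop where
  /-- Entries weakly increase from left to right across rows. -/
  row_weak : ∀ b c : shiftedDiagram lam, b.1.1 = c.1.1 → b.1.2 < c.1.2 → p b ≤ p c
  /-- Entries weakly increase from top to bottom down columns. -/
  col_weak : ∀ b c : shiftedDiagram lam, b.1.2 = c.1.2 → b.1.1 < c.1.1 → p b ≤ p c
  /-- Every primed letter appears at most once in each row. -/
  row_primed : ∀ b c : shiftedDiagram lam, b.1.1 = c.1.1 → p b = p c → (p b).IsPrimed → b = c
  /-- Every unprimed letter appears at most once in each column. -/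
  col_unprimed : ∀ b c : shiftedDiagram lam, b.1.2 = c.1.2 → p b = p c → ¬ (p b).IsPrimed → b = c

open Classical in
/-- The finite set of all primed shifted tableaux of shape `lam`. -/
noncomputable def primedShiftedTableaux {n : ℕ} (lam : Fin n → ℕ) :
    Finset (shiftedDiagram lam → PrimedLetter n) :=
  Finset.univ.filter fun p => IsPrimedShiftedTableau p

/-- The factorial generalised Schur `Q`-function `Q_lam(x;y|a)`: the sum over all primed shifted
tableaux of the product over the boxes `(i, j)` of `x_k + a_{j-i}` for an unprimed entry `k`,
and of `y_k - a_{j-i}` for a primed entry `k'`. -/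
noncomputable def generalisedFactorialSchurQ {R : Type*} [CommRing R] {n : ℕ} (lam : Fin n → ℕ)
    (x y : Fin n → R) (a : ℕ → R) : R :=
  ∑ p ∈ primedShiftedTableaux lam, ∏ c : shiftedDiagram lam,
    if (p c).IsPrimed then y (p c).abs - a (c.1.2 - c.1.1) else x (p c).abs + a (c.1.2 - c.1.1)

/-- The factorial Schur `Q`-function `Q_lam(x|a) = Q_lam(x;x|a)`. -/
noncomputable def factorialSchurQ {R : Type*} [CommRing R] {n : ℕ} (lam : Fin n → ℕ)
    (x : Fin n → R) (a : ℕ → R) : R :=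
  generalisedFactorialSchurQ lam x x a

/-!
Both sides of the identity are quotients of the same alternant. Put
`f_x(l) = (x + a₁)⋯(x + a_{l-1})`, let `V = ∏_{i<j} (x_i - x_j)`, and let
`A_lam = det [f_{x_j}(lam_i)]`. Then

* `V * s_μ(x|a) = A_{μ+δ}` (`differenceProduct_mul_fillingSum_semistandard`),
* `V * Q_lam(x;y|a) = ∏_{i≤j} (x_i + y_j) * A_lam` for a strict partition `lam` with `n` parts
  (`differenceProduct_mul_generalisedFactorialSchurQ`).

For independent variables `V` can be cancelled, and the general case follows by specialisation
(`generalisedFactorialSchurQ_add_staircase`); the theorem is the case `y = x`.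

Both formulas are proved by induction on `n`, removing the boxes with the largest letter `n`, or
with the two largest letters `n'` and `n` in the case of `Q`. The remaining tableau has a shape
given by an interlacing sequence (`fillingSum_semistandard_succ`,
`generalisedFactorialSchurQ_succ`), and the removed letters contribute a product over the rows:
in the case of `Q` they form a ribbon strip, in which each letter is forced by the shape except in
the box starting a ribbon, where both letters are possible (`fillingSum_largest`).

By multilinearity of the determinant, the sum over all interlacing sequences of these products
times the smaller alternants is one determinant, whose entries are sums over the intervals
`[lam_{i+1}, lam_i]`; sequences which are not strict do not matter, as their alternants vanish.
With `t = x_n` and `h` the entry that occurs for the Schur function (`rowSum`), a telescoping sum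
gives `(x - t) h = f_x(l) - (t + a_{l'})⋯(t + a_{l-1}) f_x(l')` (`sub_mul_rowSum`), so that
the determinant becomes `A_lam` after row operations (`factorialAlternant_succ`). The entry that
occurs for `Q` is `(x + y_n) h` (`sum_ribbonWeight`), which produces the extra factors `x_j + y_n`.
-/

open Finset

/-! ### Fillings and splitting the alphabet -/

/-- The fillings of the boxes of `D` by letters of `L` whose entries satisfy the relation `r b c`
in each pair of boxes `b`, `c`. -/
def IsFilling {α L : Type*} (r : α → α → L → L → Prop) {D : Finset α} (p : D → L) : Prop :=
  ∀ b c : D, r b c (p b) (p c)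

open Classical in
/-- The generating function of the fillings of `D` admitted by the relation `r`, where a letter
`l` in the box `c` has weight `w c l`. -/
noncomputable def fillingSum {R α L : Type*} [CommRing R] [DecidableEq α] [Fintype L] (D : Finset α)
    (r : α → α → L → L → Prop) (w : α → L → R) : R :=
  ∑ p : D → L, if IsFilling r p then ∏ c : D, w c (p c) else 0

theorem exists_isFilling_of_fillingSum_ne_zero {R α L : Type*} [CommRing R] [DecidableEq α]
    [Fintype L] {D : Finset α} {r : α → α → L → L → Prop} {w : α → L → R}
    (h : fillingSum D r w ≠ 0) :
    ∃ p : D → L, IsFilling r p := by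
  classical
  by_contra! hp
  exact h (Finset.sum_eq_zero fun p _ => if_neg (hp p))

/-- If the relation only restricts the entry of each box separately, then the generating function
is a product over the boxes. -/
theorem fillingSum_eq_prod {R α L : Type*} [CommRing R] [DecidableEq α] [Fintype L] {D : Finset α}
    {r : α → α → L → L → Prop} {w : α → L → R} (A : α → Finset L)
    (h : ∀ p : D → L, IsFilling r p ↔ ∀ c : D, p c ∈ A c) :
    fillingSum D r w = ∏ c ∈ D, ∑ l ∈ A c, w c l := by
  rw [← Finset.prod_coe_sort, Finset.prod_univ_sum, fillingSum, ← Finset.sum_filter]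
  refine Finset.sum_congr ?_ fun _ _ => rfl
  ext p
  simp [h, Fintype.mem_piFinset]

/-- Splitting the alphabet: the boxes of `D` with letters from the first part of the alphabet form
a subset `E`, and for each `E` the two parts of the filling can be chosen independently, provided
that the relation between letters of different parts does not depend on the letters. -/
theorem fillingSum_split {R α L L₁ L₂ : Type*} [CommRing R] [DecidableEq α] [Fintype L]
    [Fintype L₁] [Fintype L₂] (D : Finset α) (r : α → α → L → L → Prop) (w : α → L → R)
    (e : L₁ ⊕ L₂ ≃ L) (s : α → α → Prop) [DecidableRel s]
    (hs : ∀ b c l₁ l₂, (r b c (e (.inl l₁)) (e (.inr l₂)) ∧ r c b (e (.inr l₂)) (e (.inl l₁))) ↔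
      s b c) :
    fillingSum D r w = ∑ E ∈ D.powerset with ∀ b ∈ E, ∀ c ∈ D \ E, s b c,
      fillingSum E (fun b c l m => r b c (e (.inl l)) (e (.inl m))) (fun c l => w c (e (.inl l))) *
      fillingSum (D \ E) (fun b c l m => r b c (e (.inr l)) (e (.inr m)))
        (fun c l => w c (e (.inr l))) := by
  classical
  have hmaps : ∀ p ∈ (univ : Finset (D → L)),
      (univ.filter fun c : D => (e.symm (p c)).isLeft = true).map (Function.Embedding.subtype _)
        ∈ D.powerset := by
    intro p _
    rw [Finset.mem_powerset]
    intro c hc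
    simp only [Finset.mem_map, Function.Embedding.subtype_apply] at hc
    obtain ⟨c, _, rfl⟩ := hc
    exact c.2
  rw [fillingSum, ← Finset.sum_fiberwise_of_maps_to hmaps, Finset.sum_filter]
  refine Finset.sum_congr rfl fun E hE => ?_
  rw [Finset.mem_powerset] at hE
  -- the boxes of `D` are those of `E` and those of `D \ E`
  let f : E ⊕ ↥(D \ E) ≃ D := Equiv.ofBijective
    (Sum.elim (fun c => ⟨c, hE c.2⟩) fun c => ⟨c, (Finset.mem_sdiff.1 c.2).1⟩) (by
      constructor
      · rintro (⟨b, hb⟩ | ⟨b, hb⟩) (⟨c, hc⟩ | ⟨c, hc⟩) h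
        · simpa using h
        · obtain rfl : b = c := by simpa using h
          exact absurd hb (Finset.mem_sdiff.1 hc).2
        · obtain rfl : b = c := by simpa using h
          exact absurd hc (Finset.mem_sdiff.1 hb).2
        · simpa using h
      · rintro ⟨c, hc⟩
        by_cases h : c ∈ E
        · exact ⟨.inl ⟨c, h⟩, rfl⟩
        · exact ⟨.inr ⟨c, Finset.mem_sdiff.2 ⟨hc, h⟩⟩, rfl⟩)
  have hf1 : ∀ c, ((f (.inl c) : D) : α) = c := fun c => rfl
  have hf2 : ∀ c, ((f (.inr c) : D) : α) = c := fun c => rfl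
  let g : (E → L₁) × (↥(D \ E) → L₂) → D → L := fun q c =>
    e (Sum.map q.1 q.2 (f.symm c))
  have hg1 : ∀ q c, g q (f (.inl c)) = e (.inl (q.1 c)) := fun q c => by simp [g]
  have hg2 : ∀ q c, g q (f (.inr c)) = e (.inr (q.2 c)) := fun q c => by simp [g]
  have hvalid : ∀ q, IsFilling r (g q) ↔
      ((∀ b ∈ E, ∀ c ∈ D \ E, s b c) ∧
        IsFilling (fun b c l m => r b c (e (.inl l)) (e (.inl m))) q.1) ∧
        IsFilling (fun b c l m => r b c (e (.inr l)) (e (.inr m))) q.2 := by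
    intro q
    constructor
    · intro h
      refine ⟨⟨fun b hb c hc => (hs b c (q.1 ⟨b, hb⟩) (q.2 ⟨c, hc⟩)).1 ?_, fun b c => ?_⟩,
        fun b c => ?_⟩
      · have h1 := h (f (.inl ⟨b, hb⟩)) (f (.inr ⟨c, hc⟩))
        have h2 := h (f (.inr ⟨c, hc⟩)) (f (.inl ⟨b, hb⟩))
        rw [hg1, hg2] at h1 h2
        exact ⟨h1, h2⟩
      · have h1 := h (f (.inl b)) (f (.inl c))
        rwa [hg1, hg1] at h1
      · have h1 := h (f (.inr b)) (f (.inr c))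
        rwa [hg2, hg2] at h1
    · rintro ⟨⟨h, h1⟩, h2⟩ b c
      obtain ⟨b, rfl⟩ := f.surjective b
      obtain ⟨c, rfl⟩ := f.surjective c
      rcases b with b | b <;> rcases c with c | c
      · rw [hg1, hg1]; exact h1 b c
      · rw [hg1, hg2]; exact ((hs _ _ _ _).2 (h b b.2 c c.2)).1
      · rw [hg1, hg2]; exact ((hs _ _ _ _).2 (h c c.2 b b.2)).2
      · rw [hg2, hg2]; exact h2 b c
  have hprod : ∀ q, ∏ c : D, w c (g q c) =
      (∏ c : E, w c (e (.inl (q.1 c)))) * ∏ c : ↥(D \ E), w c (e (.inr (q.2 c))) := by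
    intro q
    rw [← f.prod_comp, Fintype.prod_sum_type]
    simp only [hg1, hg2, hf1, hf2]
  have hsum : ∑ p ∈ univ.filter (fun p : D → L =>
        (univ.filter fun c : D => (e.symm (p c)).isLeft = true).map
          (Function.Embedding.subtype _) = E),
        (if IsFilling r p then ∏ c : D, w c (p c) else 0) =
      ∑ q : (E → L₁) × (↥(D \ E) → L₂),
        if IsFilling r (g q) then ∏ c : D, w c (g q c) else 0 := by
    symm
    refine Finset.sum_bij (fun q _ => g q) ?_ ?_ ?_ fun _ _ => rfl
    · intro q _
      rw [Finset.mem_filter]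
      refine ⟨Finset.mem_univ _, ?_⟩
      ext c
      simp only [Finset.mem_map, Finset.mem_filter, Finset.mem_univ, true_and,
        Function.Embedding.subtype_apply]
      constructor
      · rintro ⟨c, hc, rfl⟩
        obtain ⟨c, rfl⟩ := f.surjective c
        rcases c with c | c
        · exact c.2
        · simp [hg2] at hc
      · intro hc
        exact ⟨f (.inl ⟨c, hc⟩), by simp [hg1], rfl⟩
    · intro q _ q' _ h
      refine Prod.ext (funext fun c => ?_) (funext fun c => ?_)
      · have := congrFun h (f (.inl c))
        simpa [hg1] using this
      · have := congrFun h (f (.inr c))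
        simpa [hg2] using this
    · intro p hp
      have hp := (Finset.mem_filter.1 hp).2
      have hl : ∀ c : E, ∃ l, p (f (.inl c)) = e (.inl l) := by
        intro c
        have hc := (Finset.ext_iff.1 hp c).2 c.2
        simp only [Finset.mem_map, Finset.mem_filter, Finset.mem_univ, true_and,
          Function.Embedding.subtype_apply] at hc
        obtain ⟨b, hb, hbc⟩ := hc
        obtain ⟨l, hl⟩ := Sum.isLeft_iff.1 hb
        have : f (.inl c) = b := Subtype.ext hbc.symm
        exact ⟨l, by rw [this, ← hl, Equiv.apply_symm_apply]⟩
      have hr : ∀ c : ↥(D \ E), ∃ l, p (f (.inr c)) = e (.inr l) := by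
        intro c
        have hc := (Finset.mem_sdiff.1 c.2).2
        have hb : ¬ (e.symm (p (f (.inr c)))).isLeft = true := by
          intro hb
          exact hc <| (Finset.ext_iff.1 hp c).1 <|
            Finset.mem_map.2 ⟨f (.inr c), by simpa using hb, rfl⟩
        rw [Sum.not_isLeft, Sum.isRight_iff] at hb
        obtain ⟨l, hl⟩ := hb
        exact ⟨l, by rw [← hl, Equiv.apply_symm_apply]⟩
      choose q₁ hq₁ using hl
      choose q₂ hq₂ using hr
      refine ⟨(q₁, q₂), Finset.mem_univ _, funext fun c => ?_⟩
      obtain ⟨c, rfl⟩ := f.surjective c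
      rcases c with c | c
      · rw [hg1, hq₁]
      · rw [hg2, hq₂]
  rw [hsum]
  split_ifs with h
  · rw [fillingSum, fillingSum, Finset.sum_mul_sum, ← Finset.sum_product',
      Finset.univ_product_univ]
    refine Fintype.sum_congr _ _ fun q => ?_
    rw [hprod, ite_zero_mul_ite_zero]
    refine if_congr ?_ rfl rfl
    rw [hvalid, and_iff_right h]
  · refine Finset.sum_eq_zero fun q _ => if_neg fun hq => h ((hvalid q).1 hq).1.1

/-- The boxes `(i, j)` with `lo i ≤ j < hi i`. -/
def rowStrip {n : ℕ} (lo hi : Fin n → ℕ) : Finset (ℕ × ℕ) :=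
  Finset.univ.biUnion fun i : Fin n => (Finset.Ico (lo i) (hi i)).image fun j => ((i : ℕ), j)

theorem mem_rowStrip {n : ℕ} {lo hi : Fin n → ℕ} {c : ℕ × ℕ} :
    c ∈ rowStrip lo hi ↔ ∃ h : c.1 < n, lo ⟨c.1, h⟩ ≤ c.2 ∧ c.2 < hi ⟨c.1, h⟩ := by
  obtain ⟨i, j⟩ := c
  simp only [rowStrip, Finset.mem_biUnion, Finset.mem_univ, true_and, Finset.mem_image,
    Finset.mem_Ico, Prod.mk.injEq]
  constructor
  · rintro ⟨k, l, hl, rfl, rfl⟩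
    exact ⟨k.2, hl⟩
  · rintro ⟨h, hl⟩
    exact ⟨⟨i, h⟩, j, hl, rfl, rfl⟩

theorem mk_mem_rowStrip {n : ℕ} {lo hi : Fin n → ℕ} {i : Fin n} {j : ℕ} :
    ((i : ℕ), j) ∈ rowStrip lo hi ↔ lo i ≤ j ∧ j < hi i := by
  rw [mem_rowStrip]
  exact ⟨fun ⟨_, h⟩ => h, fun h => ⟨i.2, h⟩⟩

theorem prod_rowStrip {R : Type*} [CommMonoid R] {n : ℕ} (lo hi : Fin n → ℕ) (g : ℕ × ℕ → R) :
    ∏ c ∈ rowStrip lo hi, g c = ∏ i : Fin n, ∏ j ∈ Finset.Ico (lo i) (hi i), g (i, j) := by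
  rw [rowStrip, Finset.prod_biUnion]
  · refine Finset.prod_congr rfl fun i _ => ?_
    rw [Finset.prod_image]
    intro j _ k _ h
    exact (Prod.mk.inj h).2
  · intro i _ k _ hik
    rw [Function.onFun, Finset.disjoint_left]
    intro c hc hc'
    simp only [Finset.mem_image] at hc hc'
    obtain ⟨j, _, rfl⟩ := hc
    obtain ⟨j', _, h⟩ := hc'
    exact hik (Fin.ext (Prod.mk.inj h).1.symm)

theorem rowStrip_sdiff {n : ℕ} {lo mid hi : Fin n → ℕ} (h : lo ≤ mid) :
    rowStrip lo hi \ rowStrip lo mid = rowStrip mid hi := by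
  ext ⟨i, j⟩
  simp only [Finset.mem_sdiff, mem_rowStrip]
  constructor
  · rintro ⟨⟨hi, h1, h2⟩, h3⟩
    refine ⟨hi, ?_, h2⟩
    by_contra! h4
    exact h3 ⟨hi, h1, h4⟩
  · rintro ⟨hi, h1, h2⟩
    exact ⟨⟨hi, (h _).trans h1, h2⟩, fun ⟨_, _, h4⟩ => (h4.trans_le h1).false⟩

theorem rowStrip_subset {n : ℕ} {lo mid hi : Fin n → ℕ} (h' : mid ≤ hi) :
    rowStrip lo mid ⊆ rowStrip lo hi := by
  intro c hc
  obtain ⟨hi, h1, h2⟩ := mem_rowStrip.1 hc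
  exact mem_rowStrip.2 ⟨hi, h1, h2.trans_le (h' _)⟩

theorem eq_of_rowStrip_eq {n : ℕ} {lo mid mid' : Fin n → ℕ} (h : lo ≤ mid) (h' : lo ≤ mid')
    (he : rowStrip lo mid = rowStrip lo mid') : mid = mid' := by
  funext i
  have h1 : ∀ j, (lo i ≤ j ∧ j < mid i) ↔ (lo i ≤ j ∧ j < mid' i) := fun j => by
    rw [← mk_mem_rowStrip, he, mk_mem_rowStrip]
  have h2 := h1 (mid i)
  have h3 := h1 (mid' i)
  have h4 : lo i ≤ mid i := h i
  have h5 : lo i ≤ mid' i := h' i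
  omega

/-- A subset of a diagram that contains with each box the boxes to the left of it is given by its
row ends. -/
theorem exists_eq_rowStrip {n : ℕ} {lo hi : Fin n → ℕ} (hlh : lo ≤ hi) {E : Finset (ℕ × ℕ)}
    (hE : E ⊆ rowStrip lo hi)
    (hl : ∀ i : Fin n, ∀ j k, lo i ≤ j → j < k → ((i : ℕ), k) ∈ E → ((i : ℕ), j) ∈ E) :
    ∃ mid, lo ≤ mid ∧ mid ≤ hi ∧ E = rowStrip lo mid := by
  have hex : ∀ i : Fin n, ∃ m, lo i ≤ m ∧ (m ≤ hi i) ∧ ((i : ℕ), m) ∉ E ∧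
      ∀ j, lo i ≤ j → j < m → ((i : ℕ), j) ∈ E := by
    intro i
    have hne : ∃ m, lo i ≤ m ∧ ((i : ℕ), m) ∉ E := ⟨hi i, hlh i, fun h => by
      have := (mk_mem_rowStrip.1 (hE h)).2
      omega⟩
    classical
    refine ⟨Nat.find hne, (Nat.find_spec hne).1, ?_, (Nat.find_spec hne).2, fun j hj hjm => ?_⟩
    · refine Nat.find_min' hne ⟨hlh i, fun h => ?_⟩
      have := (mk_mem_rowStrip.1 (hE h)).2
      omega
    · have := Nat.find_min hne hjm
      push Not at this
      exact this hj
  choose mid h1 h2 h3 h4 using hex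
  refine ⟨mid, h1, h2, ?_⟩
  ext ⟨i, j⟩
  constructor
  · intro h
    obtain ⟨hi, h5, h6⟩ := mem_rowStrip.1 (hE h)
    refine mem_rowStrip.2 ⟨hi, h5, ?_⟩
    by_contra! h7
    dsimp only at h7
    rcases h7.eq_or_lt with h8 | h8
    · exact h3 ⟨i, hi⟩ (h8 ▸ h)
    · exact h3 ⟨i, hi⟩ (hl ⟨i, hi⟩ _ j (h1 _) h8 h)
  · intro h
    obtain ⟨hi, h5, h6⟩ := mem_rowStrip.1 h
    exact h4 ⟨i, hi⟩ j h5 h6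

/-- Splitting the alphabet of the fillings of a diagram into small and large letters, where the
small letters have to precede the large ones in each row. -/
theorem fillingSum_rowStrip_split {R L L₁ L₂ : Type*} [CommRing R] [Fintype L]
    [Fintype L₁] [Fintype L₂] {n : ℕ} {lo hi : Fin n → ℕ} (hlh : lo ≤ hi)
    (r : ℕ × ℕ → ℕ × ℕ → L → L → Prop) (w : ℕ × ℕ → L → R)
    (e : L₁ ⊕ L₂ ≃ L) (s : ℕ × ℕ → ℕ × ℕ → Prop) [DecidableRel s]
    (hs : ∀ b c l₁ l₂, (r b c (e (.inl l₁)) (e (.inr l₂)) ∧ r c b (e (.inr l₂)) (e (.inl l₁))) ↔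
      s b c)
    (hrow : ∀ i j k, j < k → ¬ s (i, k) (i, j)) :
    fillingSum (rowStrip lo hi) r w =
      ∑ mid ∈ Fintype.piFinset (fun i => Finset.Icc (lo i) (hi i)) with
          ∀ b ∈ rowStrip lo mid, ∀ c ∈ rowStrip mid hi, s b c,
        fillingSum (rowStrip lo mid) (fun b c l m => r b c (e (.inl l)) (e (.inl m)))
          (fun c l => w c (e (.inl l))) *
        fillingSum (rowStrip mid hi) (fun b c l m => r b c (e (.inr l)) (e (.inr m)))
          (fun c l => w c (e (.inr l))) := by
  rw [fillingSum_split _ r w e s hs]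
  symm
  refine Finset.sum_bij (fun mid _ => rowStrip lo mid) ?_ ?_ ?_ ?_
  · intro mid hm
    simp only [Finset.mem_filter, Fintype.mem_piFinset, Finset.mem_Icc, Finset.mem_powerset]
      at hm ⊢
    refine ⟨rowStrip_subset fun i => (hm.1 i).2, ?_⟩
    rw [rowStrip_sdiff fun i => (hm.1 i).1]
    exact hm.2
  · intro mid hm mid' hm' h
    simp only [Finset.mem_filter, Fintype.mem_piFinset, Finset.mem_Icc] at hm hm'
    exact eq_of_rowStrip_eq (fun i => (hm.1 i).1) (fun i => (hm'.1 i).1) h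
  · intro E hE
    simp only [Finset.mem_filter, Finset.mem_powerset] at hE
    obtain ⟨mid, h1, h2, rfl⟩ := exists_eq_rowStrip hlh hE.1 (fun i j k h1 h2 h3 => by
      by_contra h4
      refine hrow i j k h2 (hE.2 _ h3 _ (Finset.mem_sdiff.2 ⟨?_, h4⟩))
      have := mk_mem_rowStrip.1 (hE.1 h3)
      exact mk_mem_rowStrip.2 ⟨h1, h2.trans this.2⟩)
    refine ⟨mid, ?_, rfl⟩
    simp only [Finset.mem_filter, Fintype.mem_piFinset, Finset.mem_Icc]
    refine ⟨fun i => ⟨h1 i, h2 i⟩, ?_⟩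
    rw [← rowStrip_sdiff h1]
    exact hE.2
  · intro mid hm
    simp only [Finset.mem_filter, Fintype.mem_piFinset, Finset.mem_Icc] at hm
    rw [rowStrip_sdiff fun i => (hm.1 i).1]

/-! ### Factorial powers and alternants -/

/-- The factorial power `(x + a₁)(x + a₂)⋯(x + a_{l-1})`. -/
def factorialPower {R : Type*} [CommRing R] (a : ℕ → R) (x : R) (l : ℕ) : R :=
  ∏ c ∈ Finset.Ico 1 l, (x + a c)

/-- The alternant `det [(x_j + a₁)⋯(x_j + a_{lam_i - 1})]`. -/
def factorialAlternant {R : Type*} [CommRing R] {n : ℕ} (x : Fin n → R) (a : ℕ → R)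
    (lam : Fin n → ℕ) : R :=
  (Matrix.of fun i j => factorialPower a (x j) (lam i)).det

theorem factorialAlternant_eq_zero {R : Type*} [CommRing R] {n : ℕ} (x : Fin n → R) (a : ℕ → R)
    {lam : Fin n → ℕ} {i j : Fin n} (hij : i ≠ j) (h : lam i = lam j) :
    factorialAlternant x a lam = 0 :=
  Matrix.det_zero_of_row_eq hij (by ext k; simp [h])

/-- The sum over `l' ≤ k < l` of `(t + a_{k+1})⋯(t + a_{l-1})` times the factorial power of `x` with
parameter `k`; the first factor is the weight of the boxes with the largest letter in a row of a
semistandard tableau, if the shape without this letter has the entry `k` in this row, after the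
staircase has been added to both shapes. -/
def rowSum {R : Type*} [CommRing R] (a : ℕ → R) (x t : R) (l' l : ℕ) : R :=
  ∑ k ∈ Finset.Ico l' l, (∏ c ∈ Finset.Ico (k + 1) l, (t + a c)) * factorialPower a x k

theorem sub_mul_rowSum {R : Type*} [CommRing R] (a : ℕ → R) (x t : R) {l' l : ℕ} (h' : 1 ≤ l')
    (h : l' ≤ l) :
    (x - t) * rowSum a x t l' l =
      factorialPower a x l - (∏ c ∈ Finset.Ico l' l, (t + a c)) * factorialPower a x l' := by
  induction l, h using Nat.le_induction with
  | base => simp [rowSum]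
  | succ l h ih =>
    have h1 : rowSum a x t l' (l + 1) = (t + a l) * rowSum a x t l' l + factorialPower a x l := by
      rw [rowSum, Finset.sum_Ico_succ_top h, rowSum, Finset.mul_sum]
      congr 1
      · refine Finset.sum_congr rfl fun k hk => ?_
        rw [Finset.prod_Ico_succ_top (Finset.mem_Ico.1 hk).2]
        ring
      · simp
    have h2 : factorialPower a x (l + 1) = factorialPower a x l * (x + a l) := by
      rw [factorialPower, Finset.prod_Ico_succ_top (h'.trans h), factorialPower]
    rw [h1, h2, Finset.prod_Ico_succ_top h]
    linear_combination (t + a l) * ih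

/-- The weight of a row of a shifted diagram in which the largest two letters `n' < n` fill the
contents `k, …, l - 1`, where `l'` is the length of the row below. The first of these boxes may
hold either letter, unless it lies above a box with a letter `n'` or `n`, which forces it to
hold `n'`; the other boxes hold `n`. -/
def ribbonWeight {R : Type*} [CommRing R] (a : ℕ → R) (t y : R) (l' l k : ℕ) : R :=
  if k = l then 1 else (if k = l' then y - a k else t + y) * ∏ c ∈ Finset.Ico (k + 1) l, (t + a c)

theorem sum_ribbonWeight {R : Type*} [CommRing R] (a : ℕ → R) (x t y : R) {l' l : ℕ}
    (h' : 1 ≤ l') (h : l' < l) :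
    ∑ k ∈ Finset.Icc l' l, ribbonWeight a t y l' l k * factorialPower a x k =
      (x + y) * rowSum a x t l' l := by
  have h1 := sub_mul_rowSum a x t h' h.le
  have h2 : ∑ k ∈ Finset.Ico l' l, ribbonWeight a t y l' l k * factorialPower a x k =
      (t + y) * rowSum a x t l' l -
        (∏ c ∈ Finset.Ico l' l, (t + a c)) * factorialPower a x l' := by
    rw [rowSum, Finset.sum_eq_sum_Ico_succ_bot h, Finset.sum_eq_sum_Ico_succ_bot h,
      Finset.prod_eq_prod_Ico_succ_bot h, mul_add, Finset.mul_sum]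
    have h3 : ∀ k ∈ Finset.Ico (l' + 1) l, ribbonWeight a t y l' l k * factorialPower a x k =
        (t + y) * ((∏ c ∈ Finset.Ico (k + 1) l, (t + a c)) * factorialPower a x k) := by
      intro k hk
      rw [Finset.mem_Ico] at hk
      rw [ribbonWeight, if_neg (by omega), if_neg (by omega)]
      ring
    rw [Finset.sum_congr rfl h3, ribbonWeight, if_neg h.ne, if_pos rfl]
    ring
  rw [← Finset.sum_Ico_add_eq_sum_Icc h.le, h2, ribbonWeight, if_pos rfl]
  linear_combination -h1

/-- Multilinearity of the determinant in the rows of the alternant. -/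
theorem sum_mul_factorialAlternant {R : Type*} [CommRing R] {n : ℕ} (x : Fin n → R) (a : ℕ → R)
    (I : Fin n → Finset ℕ) (W : Fin n → ℕ → R) :
    ∑ κ ∈ Fintype.piFinset I, (∏ i, W i (κ i)) * factorialAlternant x a κ =
      (Matrix.of fun i j => ∑ k ∈ I i, W i k * factorialPower a (x j) k).det := by
  have h := (Matrix.detRowAlternating (n := Fin n) (R := R)).toMultilinearMap.map_sum_finset
    (fun i k => W i k • fun j => factorialPower a (x j) k) I
  simp only [MultilinearMap.map_smul_univ] at h
  have h2 : (Matrix.of fun i j => ∑ k ∈ I i, W i k * factorialPower a (x j) k) =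
      Matrix.of fun i => ∑ k ∈ I i, W i k • fun j => factorialPower a (x j) k := by
    ext i j
    simp [Finset.sum_apply]
  rw [h2]
  exact h.symm

/-- Subtracting from each row a multiple of the next one leaves only the last entry of the last
column. -/
theorem factorialAlternant_succ {R : Type*} [CommRing R] {n : ℕ} (x : Fin (n + 1) → R) (a : ℕ → R)
    {lam : Fin (n + 1) → ℕ} (hlam : Antitone lam) (hpos : ∀ i, 1 ≤ lam i) :
    factorialAlternant x a lam = factorialPower a (x (Fin.last n)) (lam (Fin.last n)) *
      (∏ j : Fin n, (x j.castSucc - x (Fin.last n))) *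
      (Matrix.of fun i j : Fin n => rowSum a (x j.castSucc) (x (Fin.last n)) (lam i.succ)
        (lam i.castSucc)).det := by
  set t := x (Fin.last n) with ht
  set d : Fin n → R := fun i => ∏ c ∈ Finset.Ico (lam i.succ) (lam i.castSucc), (t + a c) with hd
  have hle : ∀ i : Fin n, lam i.succ ≤ lam i.castSucc := fun i =>
    hlam (Fin.castSucc_lt_succ (i := i)).le
  let B : Matrix (Fin (n + 1)) (Fin (n + 1)) R := Matrix.of fun i j =>
    Fin.lastCases (motive := fun _ => R) (factorialPower a (x j) (lam (Fin.last n)))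
      (fun i => factorialPower a (x j) (lam i.castSucc) -
        d i * factorialPower a (x j) (lam i.succ)) i
  -- the rows are reversed, since the row operations use the following row
  have h1 : factorialAlternant x a lam = B.det := by
    rw [factorialAlternant, ← Matrix.det_submatrix_equiv_self Fin.revPerm,
      ← Matrix.det_submatrix_equiv_self Fin.revPerm B]
    refine Matrix.det_eq_of_forall_row_eq_smul_add_pred (fun i => d i.rev) ?_ ?_
    · intro j
      simp [B]
    · intro i j
      simp [B, Fin.rev_succ, Fin.rev_castSucc]
  have h2 : ∀ i : Fin n, B i.castSucc (Fin.last n) = 0 := by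
    intro i
    have h3 : factorialPower a t (lam i.castSucc) =
        factorialPower a t (lam i.succ) * d i :=
      (Finset.prod_Ico_consecutive _ (hpos _) (hle i)).symm
    simp only [B, Matrix.of_apply, Fin.lastCases_castSucc, ← ht, h3]
    ring
  -- expansion along the last column
  rw [h1, Matrix.det_succ_column B (Fin.last n), Fin.sum_univ_castSucc]
  simp only [h2, mul_zero, zero_mul, Finset.sum_const_zero, zero_add]
  have h4 : B.submatrix (Fin.last n).succAbove (Fin.last n).succAbove =
      Matrix.of fun i j => (x j.castSucc - t) *
        (Matrix.of fun i j : Fin n => rowSum a (x j.castSucc) t (lam i.succ)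
          (lam i.castSucc)) i j := by
    ext i j
    simp only [B, Matrix.submatrix_apply, Matrix.of_apply, Fin.succAbove_last,
      Fin.lastCases_castSucc, sub_mul_rowSum a _ t (hpos _) (hle i), hd]
  have h5 : B (Fin.last n) (Fin.last n) = factorialPower a t (lam (Fin.last n)) := by
    simp [B, ht]
  rw [h4, h5, Matrix.det_mul_row, ← mul_assoc, Fin.val_last, Even.neg_one_pow ⟨n, rfl⟩, one_mul]

theorem prod_prod_Ioi_castSucc {R : Type*} [CommMonoid R] {n : ℕ}
    (g : Fin (n + 1) → Fin (n + 1) → R) :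
    ∏ i, ∏ j ∈ Finset.Ioi i, g i j =
      (∏ i : Fin n, ∏ j ∈ Finset.Ioi i, g i.castSucc j.castSucc) *
        ∏ i : Fin n, g i.castSucc (Fin.last n) := by
  have h : ∀ (m : ℕ) (f : Fin m → Fin m → R), ∏ i, ∏ j ∈ Finset.Ioi i, f i j =
      ∏ i, ∏ j, if i < j then f i j else 1 := by
    intro m f
    refine Finset.prod_congr rfl fun i _ => ?_
    rw [← Finset.prod_filter]
    congr 1
    ext j
    simp
  rw [h, h, Fin.prod_univ_castSucc]
  simp [Fin.prod_univ_castSucc, Finset.prod_mul_distrib, Fin.castSucc_lt_last,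
    (Fin.le_last _).not_gt]

/-! ### Primed shifted tableaux: the shape left by the smaller letters -/

/-- The condition that the entries `p`, `q` of a primed shifted tableau satisfy in the boxes
`b`, `c`. -/
def ShiftedRel {n : ℕ} (b c : ℕ × ℕ) (p q : PrimedLetter n) : Prop :=
  (b.1 = c.1 → b.2 < c.2 → p ≤ q) ∧ (b.2 = c.2 → b.1 < c.1 → p ≤ q) ∧
    (b.1 = c.1 → p = q → p.IsPrimed → b = c) ∧ (b.2 = c.2 → p = q → ¬ p.IsPrimed → b = c)

/-- The weight of the letter `p` in the box `c` of a primed shifted tableau. -/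
def shiftedWeight {R : Type*} [CommRing R] {n : ℕ} (x y : Fin n → R) (a : ℕ → R) (c : ℕ × ℕ)
    (p : PrimedLetter n) : R :=
  if p.IsPrimed then y p.abs - a (c.2 - c.1) else x p.abs + a (c.2 - c.1)

theorem generalisedFactorialSchurQ_eq_fillingSum {R : Type*} [CommRing R] {n : ℕ}
    (lam : Fin n → ℕ) (x y : Fin n → R) (a : ℕ → R) :
    generalisedFactorialSchurQ lam x y a =
      fillingSum (rowStrip (fun i => i) fun i => i + lam i) ShiftedRel (shiftedWeight x y a) := by
  classical
  have h : ∀ p : shiftedDiagram lam → PrimedLetter n, IsPrimedShiftedTableau p ↔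
      IsFilling ShiftedRel p := by
    intro p
    constructor
    · intro h b c
      exact ⟨h.row_weak b c, h.col_weak b c,
        fun h1 h2 h3 => congrArg Subtype.val (h.row_primed b c h1 h2 h3),
        fun h1 h2 h3 => congrArg Subtype.val (h.col_unprimed b c h1 h2 h3)⟩
    · intro h
      exact ⟨fun b c => (h b c).1, fun b c => (h b c).2.1,
        fun b c h1 h2 h3 => Subtype.ext ((h b c).2.2.1 h1 h2 h3),
        fun b c h1 h2 h3 => Subtype.ext ((h b c).2.2.2 h1 h2 h3)⟩
  rw [generalisedFactorialSchurQ, primedShiftedTableaux, Finset.sum_filter]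
  simp only [h]
  rfl

/-- The alphabet `1' < 1 < ⋯ < (n+1)' < n+1` consists of the first `2n` letters and the letters
`(n+1)'` and `n+1`. -/
noncomputable def primedLetterSplit (n : ℕ) : PrimedLetter n ⊕ Bool ≃ PrimedLetter (n + 1) :=
  Equiv.ofBijective
    (Sum.elim (fun p => toLex ((ofLex p).1.castSucc, (ofLex p).2)) fun b => toLex (Fin.last n, b))
    (by
      constructor
      · rintro (⟨i, b⟩ | b) (⟨j, c⟩ | c) h
        · have h1 := Prod.mk.inj (toLex.injective h)
          obtain ⟨h1, rfl⟩ := h1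
          obtain rfl := Fin.castSucc_injective _ h1
          rfl
        · exact absurd (Prod.mk.inj (toLex.injective h)).1 (Fin.castSucc_lt_last _).ne
        · exact absurd (Prod.mk.inj (toLex.injective h)).1 (Fin.castSucc_lt_last _).ne'
        · exact congrArg Sum.inr (Prod.mk.inj (toLex.injective h)).2
      · rintro ⟨i, b⟩
        induction i using Fin.lastCases with
        | last => exact ⟨.inr b, rfl⟩
        | cast i => exact ⟨.inl (toLex (i, b)), rfl⟩)

theorem primedLetterSplit_inl_le {n : ℕ} (p q : PrimedLetter n) :
    primedLetterSplit n (.inl p) ≤ primedLetterSplit n (.inl q) ↔ p ≤ q := by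
  change toLex (_, _) ≤ toLex (_, _) ↔ _
  rw [Prod.Lex.toLex_le_toLex, Prod.Lex.le_iff]
  simp [Fin.castSucc_lt_castSucc_iff]

theorem primedLetterSplit_inr_le {n : ℕ} (b c : Bool) :
    primedLetterSplit n (.inr b) ≤ primedLetterSplit n (.inr c) ↔ b ≤ c := by
  change toLex (_, _) ≤ toLex (_, _) ↔ _
  rw [Prod.Lex.toLex_le_toLex]
  simp

theorem primedLetterSplit_inl_lt_inr {n : ℕ} (p : PrimedLetter n) (b : Bool) :
    primedLetterSplit n (.inl p) < primedLetterSplit n (.inr b) := by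
  change toLex (_, _) < toLex (_, _)
  rw [Prod.Lex.toLex_lt_toLex]
  exact Or.inl (Fin.castSucc_lt_last _)

theorem isPrimed_primedLetterSplit_inl {n : ℕ} (p : PrimedLetter n) :
    (primedLetterSplit n (.inl p)).IsPrimed ↔ p.IsPrimed := Iff.rfl

theorem isPrimed_primedLetterSplit_inr {n : ℕ} (b : Bool) :
    (primedLetterSplit n (.inr b)).IsPrimed ↔ b = false := Iff.rfl

theorem shiftedRel_inl {n : ℕ} (b c : ℕ × ℕ) (p q : PrimedLetter n) :
    ShiftedRel b c (primedLetterSplit n (.inl p)) (primedLetterSplit n (.inl q)) ↔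
      ShiftedRel b c p q := by
  simp only [ShiftedRel, primedLetterSplit_inl_le, isPrimed_primedLetterSplit_inl,
    EmbeddingLike.apply_eq_iff_eq, Sum.inl.injEq]

theorem shiftedRel_inr {n : ℕ} (b c : ℕ × ℕ) (p q : Bool) :
    ShiftedRel b c (primedLetterSplit n (.inr p)) (primedLetterSplit n (.inr q)) ↔
      (b.1 = c.1 → b.2 < c.2 → p ≤ q) ∧ (b.2 = c.2 → b.1 < c.1 → p ≤ q) ∧
      (b.1 = c.1 → p = q → p = false → b = c) ∧ (b.2 = c.2 → p = q → p = true → b = c) := by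
  simp only [ShiftedRel, primedLetterSplit_inr_le, isPrimed_primedLetterSplit_inr,
    EmbeddingLike.apply_eq_iff_eq, Sum.inr.injEq, Bool.not_eq_false]

/-- `b` is neither to the right of `c` in the same row nor below `c` in the same column. -/
def NotBeyond (b c : ℕ × ℕ) : Prop :=
  ¬ (b.1 = c.1 ∧ c.2 < b.2) ∧ ¬ (b.2 = c.2 ∧ c.1 < b.1)

instance : DecidableRel NotBeyond := fun _ _ => inferInstanceAs (Decidable (_ ∧ _))

theorem shiftedRel_inl_inr {n : ℕ} (b c : ℕ × ℕ) (p : PrimedLetter n) (q : Bool) :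
    (ShiftedRel b c (primedLetterSplit n (.inl p)) (primedLetterSplit n (.inr q)) ∧
      ShiftedRel c b (primedLetterSplit n (.inr q)) (primedLetterSplit n (.inl p))) ↔
      NotBeyond b c := by
  have h1 := primedLetterSplit_inl_lt_inr p q
  simp only [ShiftedRel, h1.le, h1.ne, h1.ne', h1.not_ge, NotBeyond, implies_true, true_and,
    false_implies, and_true, not_and, imp_false, @eq_comm _ c.1, @eq_comm _ c.2]

/-- In three boxes `(i, j)`, `(i, j + 1)`, `(i + 1, j + 1)` the absolute values of the entries
cannot all be equal: the middle letter could be neither primed nor unprimed. -/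
theorem abs_lt_abs_of_isFilling {n : ℕ} {D : Finset (ℕ × ℕ)} {p : D → PrimedLetter n}
    (hp : IsFilling ShiftedRel p) {i j : ℕ} (h1 : (i, j) ∈ D) (h2 : (i, j + 1) ∈ D)
    (h3 : (i + 1, j + 1) ∈ D) : (p ⟨_, h1⟩).abs < (p ⟨_, h3⟩).abs := by
  have h12 := (hp ⟨_, h1⟩ ⟨_, h2⟩).1 rfl (Nat.lt_succ_self j)
  have h23 := (hp ⟨_, h2⟩ ⟨_, h3⟩).2.1 rfl (Nat.lt_succ_self i)
  have h12' := (hp ⟨_, h1⟩ ⟨_, h2⟩).2.2.1 rfl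
  have h23' := (hp ⟨_, h2⟩ ⟨_, h3⟩).2.2.2 rfl
  simp only [Prod.mk.injEq, true_and, and_true,
    (Nat.succ_ne_self _).symm, imp_false, not_not] at h12' h23'
  generalize p ⟨_, h1⟩ = p1 at *
  generalize p ⟨_, h2⟩ = p2 at *
  generalize p ⟨_, h3⟩ = p3 at *
  obtain ⟨k1, b1⟩ := p1
  obtain ⟨k2, b2⟩ := p2
  obtain ⟨k3, b3⟩ := p3
  change toLex (k1, b1) ≤ toLex (k2, b2) at h12
  change toLex (k2, b2) ≤ toLex (k3, b3) at h23
  change toLex (k1, b1) = toLex (k2, b2) → ¬ b1 = false at h12'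
  change toLex (k2, b2) = toLex (k3, b3) → b2 = false at h23'
  change k1 < k3
  rw [Prod.Lex.toLex_le_toLex] at h12 h23
  simp only [EmbeddingLike.apply_eq_iff_eq, Prod.mk.injEq] at h12 h23 h12' h23'
  rcases h12 with h | ⟨rfl, h⟩
  · rcases h23 with h' | ⟨rfl, h'⟩
    · exact h.trans h'
    · exact h
  · rcases h23 with h' | ⟨rfl, h'⟩
    · exact h'
    · exfalso
      revert h h' h12' h23'
      cases b1 <;> cases b2 <;> cases b3 <;> simp

theorem antitone_val_add_of_strictAnti {n : ℕ} {lam : Fin n → ℕ} (h : StrictAnti lam) :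
    Antitone fun i : Fin n => (i : ℕ) + lam i := by
  cases n with
  | zero => exact fun i => i.elim0
  | succ n =>
    refine Fin.antitone_iff_succ_le.2 fun i => ?_
    have := h (Fin.castSucc_lt_succ (i := i))
    simp only [Fin.val_succ, Fin.val_castSucc]
    omega

theorem strictAnti_of_antitone_val_add {n : ℕ} {lam : Fin n → ℕ}
    (h : Antitone fun i : Fin n => (i : ℕ) + lam i) : StrictAnti lam := by
  intro i j hij
  have := h hij.le
  have : (i : ℕ) < j := hij
  dsimp only at *
  omega

/-- In a primed shifted tableau of shape `lam` with `n + 1` rows, the letters other than the largest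
two leave the last row empty, and their row ends `mid` are those of a strict partition which
interlaces with `lam`. The filling `p` by smaller letters and the filling `q` by the largest two
both enter through the diagonal condition `abs_lt_abs_of_isFilling`. -/
theorem interlacing_of_isFilling {n : ℕ} {lam mid : Fin (n + 1) → ℕ} (hlam : StrictAnti lam)
    (hpos : ∀ i, 0 < lam i) (h1 : ∀ i : Fin (n + 1), (i : ℕ) ≤ mid i)
    (h2 : ∀ i : Fin (n + 1), mid i ≤ i + lam i)
    (hs : ∀ b ∈ rowStrip (fun i => i) mid, ∀ c ∈ rowStrip mid (fun i => i + lam i), NotBeyond b c)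
    {p : rowStrip (fun i : Fin (n + 1) => (i : ℕ)) mid → PrimedLetter n}
    (hp : IsFilling ShiftedRel p)
    {q : rowStrip mid (fun i : Fin (n + 1) => i + lam i) → Bool}
    (hq : IsFilling (fun b c l m => ShiftedRel b c (primedLetterSplit n (.inr l))
      (primedLetterSplit n (.inr m))) q) :
    (∀ i : Fin n, (i : ℕ) + lam i.succ ≤ mid i.castSucc) ∧ mid (Fin.last n) = n ∧
      Antitone mid := by
  have hanti := antitone_val_add_of_strictAnti hlam
  have hdown : ∀ (i j : Fin (n + 1)) (k : ℕ), i < j → (j : ℕ) ≤ k → mid i ≤ k → k < i + lam i →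
      mid j ≤ k := by
    intro i j k hij hjk hik hk
    by_contra! hkj
    exact (hs (j, k) (mk_mem_rowStrip.2 ⟨hjk, hkj⟩) (i, k) (mk_mem_rowStrip.2 ⟨hik, hk⟩)).2
      ⟨rfl, hij⟩
  have ha : ∀ i : Fin n, (i : ℕ) + lam i.succ ≤ mid i.castSucc := by
    intro i
    by_contra! h
    -- otherwise the largest two letters fill the first two free boxes of row `i` and the box below
    -- the second one
    have hi := h1 i.castSucc
    have h3 : lam i.succ < lam i.castSucc := hlam (Fin.castSucc_lt_succ (i := i))
    have h4 := hdown i.castSucc i.succ (mid i.castSucc + 1) (Fin.castSucc_lt_succ (i := i))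
      (by simpa using hi) (by omega) (by simp only [Fin.val_castSucc]; omega)
    have m1 : ((i : ℕ), mid i.castSucc) ∈ rowStrip mid (fun i : Fin (n + 1) => i + lam i) :=
      (mk_mem_rowStrip (i := i.castSucc)).2 ⟨le_rfl, by simp only [Fin.val_castSucc]; omega⟩
    have m2 : ((i : ℕ), mid i.castSucc + 1) ∈ rowStrip mid (fun i : Fin (n + 1) => i + lam i) :=
      (mk_mem_rowStrip (i := i.castSucc)).2 ⟨by omega, by simp only [Fin.val_castSucc]; omega⟩
    have m3 : ((i : ℕ) + 1, mid i.castSucc + 1) ∈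
        rowStrip mid (fun i : Fin (n + 1) => i + lam i) :=
      (mk_mem_rowStrip (i := i.succ)).2 ⟨h4, by simp only [Fin.val_succ]; omega⟩
    exact (abs_lt_abs_of_isFilling (p := fun c => primedLetterSplit n (.inr (q c))) hq
      m1 m2 m3).false
  have hc : Antitone mid := by
    intro i j hij
    rcases hij.eq_or_lt with rfl | hij
    · exact le_rfl
    by_contra! h
    have hjn : (j : ℕ) ≤ mid i := by
      obtain ⟨i, rfl⟩ := Fin.exists_castSucc_eq.2 (hij.trans_le (Fin.le_last j)).ne
      have h3 := ha i
      have h4 := hanti (Fin.le_last i.succ)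
      have h5 := hpos (Fin.last n)
      simp only [Fin.val_last, Fin.val_succ] at h4
      have := j.is_le
      omega
    have h6 := hanti hij.le
    have := hdown i j (mid i) hij hjn le_rfl (h.trans_le ((h2 j).trans h6))
    omega
  refine ⟨ha, ?_, hc⟩
  by_contra hn
  have hn : n + 1 ≤ mid (Fin.last n) := lt_of_le_of_ne (h1 (Fin.last n)) (Ne.symm hn)
  have hm : ∀ i ≤ n, ∀ j, i ≤ j → j ≤ n →
      (i, j) ∈ rowStrip (fun i : Fin (n + 1) => (i : ℕ)) mid := by
    intro i hi j hij hj
    refine (mk_mem_rowStrip (i := ⟨i, Nat.lt_succ_of_le hi⟩)).2 ⟨hij, ?_⟩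
    have := hc (Fin.le_last ⟨i, Nat.lt_succ_of_le hi⟩)
    omega
  -- the absolute values increase along the main diagonal
  have hd : ∀ i (hi : i ≤ n), i ≤ ((p ⟨_, hm i hi i le_rfl hi⟩).abs : ℕ) := by
    intro i
    induction i with
    | zero => exact fun _ => Nat.zero_le _
    | succ i ih =>
      intro hi
      have h3 := ih (by omega)
      have h4 : ((p _).abs : ℕ) < _ := abs_lt_abs_of_isFilling hp
        (hm i (by omega) i le_rfl (by omega)) (hm i (by omega) (i + 1) (by omega) hi)
        (hm (i + 1) hi (i + 1) le_rfl hi)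
      omega
  have := hd n le_rfl
  have := (p ⟨_, hm n le_rfl n le_rfl le_rfl⟩).abs.2
  omega

open Classical in
/-- The letters `(n+1)'` (`false`) and `n+1` (`true`) that the box `c` may hold, if the rows of
the remaining letters end at `mid`: a box which is not the first one of its row must
hold `n+1`, and a box above another box must hold `(n+1)'`. -/
noncomputable def largestLetters {n : ℕ} (lam mid : Fin (n + 1) → ℕ) (c : ℕ × ℕ) : Finset Bool :=
  Finset.univ.filter fun l =>
    (∀ i : Fin (n + 1), (i : ℕ) = c.1 → mid i < c.2 → l = true) ∧
      ∀ i : Fin n, (i : ℕ) = c.1 → c.2 = i + lam i.succ → l = false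

theorem isFilling_largest_iff {n : ℕ} {lam mid : Fin (n + 1) → ℕ} (hlam : StrictAnti lam)
    (ha : ∀ i : Fin n, (i : ℕ) + lam i.succ ≤ mid i.castSucc) (hc : Antitone mid)
    (q : rowStrip mid (fun i : Fin (n + 1) => i + lam i) → Bool) :
    IsFilling (fun b c l m => ShiftedRel b c (primedLetterSplit n (.inr l))
      (primedLetterSplit n (.inr m))) q ↔
      ∀ c : rowStrip mid (fun i : Fin (n + 1) => i + lam i), q c ∈ largestLetters lam mid c := by
  have hanti := antitone_val_add_of_strictAnti hlam
  simp only [IsFilling, shiftedRel_inr, largestLetters, Finset.mem_filter, Finset.mem_univ,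
    true_and]
  constructor
  · rintro h ⟨⟨i, j⟩, hm⟩
    constructor
    · intro i' hi hj
      obtain rfl : (i' : ℕ) = i := hi
      have hm' := mk_mem_rowStrip.1 hm
      have hm0 : ((i' : ℕ), mid i') ∈ rowStrip mid (fun i : Fin (n + 1) => i + lam i) :=
        mk_mem_rowStrip.2 ⟨le_rfl, hm'.1.trans_lt hm'.2⟩
      have h1 := h ⟨_, hm0⟩ ⟨_, hm⟩
      by_contra h2
      rw [Bool.not_eq_true] at h2
      have h3 := h1.1 rfl hj
      rw [h2] at h3
      replace h3 := le_bot_iff.1 h3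
      have h4 := h1.2.2.1 rfl (h3.trans h2.symm) h3
      exact hj.ne (congrArg Prod.snd h4)
    · intro i' hi hj
      obtain rfl : (i' : ℕ) = i := hi
      dsimp only at hj
      subst hj
      have hm' := (mk_mem_rowStrip (i := i'.castSucc)).1 hm
      have h5 := hc (Fin.castSucc_lt_succ (i := i')).le
      have hm0 : ((i' : ℕ) + 1, i' + lam i'.succ) ∈
          rowStrip mid (fun i : Fin (n + 1) => i + lam i) :=
        (mk_mem_rowStrip (i := i'.succ)).2 ⟨h5.trans hm'.1, by
          simp only [Fin.val_succ]; omega⟩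
      have h1 := h ⟨_, hm⟩ ⟨_, hm0⟩
      by_contra h2
      rw [Bool.not_eq_false] at h2
      have h3 := h1.2.1 rfl (Nat.lt_succ_self _)
      rw [h2] at h3
      replace h3 := top_le_iff.1 h3
      have h4 := h1.2.2.2 rfl (h2.trans h3.symm) h2
      exact Nat.succ_ne_self _ (congrArg Prod.fst h4).symm
  · intro h
    have hcol : ∀ b c : rowStrip mid (fun i : Fin (n + 1) => i + lam i), b.1.2 = c.1.2 →
        b.1.1 < c.1.1 → q b = false := by
      rintro ⟨⟨i, j⟩, hb⟩ ⟨⟨i', j'⟩, hc'⟩ hj hi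
      obtain rfl : j = j' := hj
      replace hi : i < i' := hi
      obtain ⟨h1, h2, h3⟩ := mem_rowStrip.1 hb
      obtain ⟨h4, h5, h6⟩ := mem_rowStrip.1 hc'
      dsimp only at *
      have h7 : i < n := by omega
      refine (h _).2 ⟨i, h7⟩ rfl ?_
      have h8 := ha ⟨i, h7⟩
      have h9 := hanti (show (⟨i, h7⟩ : Fin n).succ ≤ ⟨i', h4⟩ by
        rw [Fin.le_def]; simp; omega)
      simp only [Fin.val_succ] at h9
      have h10 : mid ⟨i, h1⟩ = mid (Fin.castSucc ⟨i, h7⟩) := rfl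
      dsimp only at *
      omega
    have hrow : ∀ b c : rowStrip mid (fun i : Fin (n + 1) => i + lam i), b.1.1 = c.1.1 →
        b.1.2 < c.1.2 → q c = true := by
      rintro ⟨⟨i, j⟩, hb⟩ ⟨⟨i', j'⟩, hc'⟩ hi hj
      obtain rfl : i = i' := hi
      obtain ⟨h1, h2, h3⟩ := mem_rowStrip.1 hb
      exact (h _).1 ⟨i, h1⟩ rfl (lt_of_le_of_lt h2 hj)
    intro b c
    refine ⟨fun h1 h2 => ?_, fun h1 h2 => ?_, fun h1 h2 h3 => ?_, fun h1 h2 h3 => ?_⟩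
    · rw [hrow b c h1 h2]
      exact Bool.le_true _
    · rw [hcol b c h1 h2]
      exact Bool.false_le _
    · rcases lt_trichotomy b.1.2 c.1.2 with h4 | h4 | h4
      · have := hrow b c h1 h4
        simp_all
      · exact Prod.ext h1 h4
      · have := hrow c b h1.symm h4
        simp_all
    · rcases lt_trichotomy b.1.1 c.1.1 with h4 | h4 | h4
      · have := hcol b c h1 h4
        simp_all
      · exact Prod.ext h4 h1
      · have := hcol c b h1.symm h4
        simp_all

/-! ### Factorial `Q`-functions as quotients of alternants -/

/-- The row ends of the shifted diagram of `κ`, with an empty row added. -/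
def shiftedRowEnds {n : ℕ} (κ : Fin n → ℕ) (i : Fin (n + 1)) : ℕ :=
  i + Fin.snoc (α := fun _ => ℕ) κ 0 i

theorem shiftedRowEnds_castSucc {n : ℕ} (κ : Fin n → ℕ) (i : Fin n) :
    shiftedRowEnds κ i.castSucc = i + κ i := by simp [shiftedRowEnds]

theorem shiftedRowEnds_last {n : ℕ} (κ : Fin n → ℕ) :
    shiftedRowEnds κ (Fin.last n) = n := by simp [shiftedRowEnds]

theorem rowStrip_eq_of_castSucc {n : ℕ} {lo hi : Fin (n + 1) → ℕ}
    (h : hi (Fin.last n) ≤ lo (Fin.last n)) :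
    rowStrip lo hi = rowStrip (fun i => lo i.castSucc) fun i => hi i.castSucc := by
  ext ⟨i, j⟩
  simp only [mem_rowStrip]
  constructor
  · rintro ⟨h1, h2, h3⟩
    rcases (Nat.lt_succ_iff.1 h1).eq_or_lt with rfl | h4
    · exact absurd (h2.trans_lt h3) h.not_gt
    · exact ⟨h4, h2, h3⟩
  · rintro ⟨h1, h2, h3⟩
    exact ⟨h1.trans (Nat.lt_succ_self n), h2, h3⟩

theorem rowStrip_shiftedRowEnds {n : ℕ} (κ : Fin n → ℕ) :
    rowStrip (fun i : Fin (n + 1) => (i : ℕ)) (shiftedRowEnds κ) =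
      rowStrip (fun i : Fin n => (i : ℕ)) fun i => i + κ i := by
  rw [rowStrip_eq_of_castSucc (shiftedRowEnds_last κ).le]
  simp only [shiftedRowEnds_castSucc, Fin.val_castSucc]

theorem shiftedWeight_inl {R : Type*} [CommRing R] {n : ℕ} (x y : Fin (n + 1) → R) (a : ℕ → R)
    (c : ℕ × ℕ) (p : PrimedLetter n) :
    shiftedWeight x y a c (primedLetterSplit n (.inl p)) =
      shiftedWeight (fun i => x i.castSucc) (fun i => y i.castSucc) a c p := rfl

theorem shiftedWeight_inr {R : Type*} [CommRing R] {n : ℕ} (x y : Fin (n + 1) → R) (a : ℕ → R)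
    (c : ℕ × ℕ) (b : Bool) :
    shiftedWeight x y a c (primedLetterSplit n (.inr b)) =
      if b = false then y (Fin.last n) - a (c.2 - c.1) else x (Fin.last n) + a (c.2 - c.1) := by
  cases b <;> rfl

theorem prod_Ico_add_sub {R : Type*} [CommMonoid R] (g : ℕ → R) (i k l : ℕ) :
    ∏ j ∈ Finset.Ico (i + k) (i + l), g (j - i) = ∏ c ∈ Finset.Ico k l, g c := by
  rw [add_comm i k, add_comm i l, ← Finset.prod_Ico_add']
  exact Finset.prod_congr rfl fun c _ => by rw [Nat.add_sub_cancel]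

/-- The boxes holding the largest two letters contribute a product over the rows. -/
theorem fillingSum_largest {R : Type*} [CommRing R] {n : ℕ} (x y : Fin (n + 1) → R) (a : ℕ → R)
    {lam : Fin (n + 1) → ℕ} (hlam : StrictAnti lam) (hpos : ∀ i, 0 < lam i) {κ : Fin n → ℕ}
    (h1 : ∀ i, lam i.succ ≤ κ i) (h2 : ∀ i, κ i ≤ lam i.castSucc)
    (hc : Antitone (shiftedRowEnds κ)) :
    fillingSum (rowStrip (shiftedRowEnds κ) fun i : Fin (n + 1) => i + lam i)
        (fun b c l m => ShiftedRel b c (primedLetterSplit n (.inr l))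
          (primedLetterSplit n (.inr m)))
        (fun c l => shiftedWeight x y a c (primedLetterSplit n (.inr l))) =
      (x (Fin.last n) + y (Fin.last n)) * factorialPower a (x (Fin.last n)) (lam (Fin.last n)) *
        ∏ i : Fin n, ribbonWeight a (x (Fin.last n)) (y (Fin.last n)) (lam i.succ)
          (lam i.castSucc) (κ i) := by
  set t := x (Fin.last n) with ht
  set u := y (Fin.last n) with hu
  have ha : ∀ i : Fin n, (i : ℕ) + lam i.succ ≤ shiftedRowEnds κ i.castSucc := fun i => by
    rw [shiftedRowEnds_castSucc]
    exact Nat.add_le_add_left (h1 i) _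
  rw [fillingSum_eq_prod (largestLetters lam (shiftedRowEnds κ))
    (isFilling_largest_iff hlam ha hc), prod_rowStrip, Fin.prod_univ_castSucc, mul_comm]
  simp only [shiftedWeight_inr, ← ht, ← hu, shiftedRowEnds_castSucc, shiftedRowEnds_last,
    Fin.val_castSucc, Fin.val_last]
  -- the boxes of a row other than the first
  have hrest : ∀ (i : Fin (n + 1)) (j : ℕ), shiftedRowEnds κ i < j →
      ∑ l ∈ largestLetters lam (shiftedRowEnds κ) (i, j),
        (if l = false then u - a (j - i) else t + a (j - i)) = t + a (j - i) := by
    intro i j hj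
    have : largestLetters lam (shiftedRowEnds κ) (i, j) = {true} := by
      ext l
      simp only [largestLetters, Finset.mem_filter, Finset.mem_univ, true_and,
        Finset.mem_singleton]
      constructor
      · exact fun h => h.1 i rfl hj
      · rintro rfl
        refine ⟨fun _ _ _ => rfl, fun k hk hjk => ?_⟩
        obtain rfl : i = k.castSucc := Fin.ext hk.symm
        have := ha k
        omega
    rw [this, Finset.sum_singleton, if_neg (by simp)]
  congr 1
  · rw [Finset.prod_eq_prod_Ico_succ_bot (by have := hpos (Fin.last n); omega)]
    congr 1
    · have : largestLetters lam (shiftedRowEnds κ) (n, n) = Finset.univ := by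
        ext l
        simp only [largestLetters, Finset.mem_filter, Finset.mem_univ, true_and, iff_true]
        refine ⟨fun i hi h => ?_, fun i hi => absurd hi i.2.ne⟩
        obtain rfl : i = Fin.last n := Fin.ext hi
        rw [shiftedRowEnds_last] at h
        exact absurd h (lt_irrefl _)
      rw [this, Fintype.sum_bool]
      simp
    · refine Eq.trans (Finset.prod_congr rfl fun j hj => ?_)
        (prod_Ico_add_sub (fun c => t + a c) n 1 _)
      have := hrest (Fin.last n) j (by
        rw [shiftedRowEnds_last]; exact (Finset.mem_Ico.1 hj).1)
      simpa using this
  · refine Finset.prod_congr rfl fun i _ => ?_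
    rw [ribbonWeight]
    rcases (h2 i).eq_or_lt with h3 | h3
    · rw [if_pos h3, h3, Finset.Ico_self, Finset.prod_empty]
    rw [if_neg h3.ne, Finset.prod_eq_prod_Ico_succ_bot (by omega)]
    congr 1
    · have : ∀ l, l ∈ largestLetters lam (shiftedRowEnds κ) (i, i + κ i) ↔
          (κ i = lam i.succ → l = false) := by
        intro l
        simp only [largestLetters, Finset.mem_filter, Finset.mem_univ, true_and]
        constructor
        · exact fun h h4 => h.2 i rfl (by rw [h4])
        · refine fun h => ⟨fun k hk h4 => ?_, fun k hk h4 => ?_⟩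
          · obtain rfl : k = i.castSucc := Fin.ext hk
            rw [shiftedRowEnds_castSucc] at h4
            exact absurd h4 (lt_irrefl _)
          · obtain rfl : k = i := Fin.ext hk
            exact h (Nat.add_left_cancel h4)
      split_ifs with h4
      · have h5 : largestLetters lam (shiftedRowEnds κ) (i, i + κ i) = {false} := by
          ext l
          rw [this, Finset.mem_singleton]
          exact ⟨fun h => h h4, fun h _ => h⟩
        rw [h5, Finset.sum_singleton, if_pos rfl, Nat.add_sub_cancel_left]
      · have h5 : largestLetters lam (shiftedRowEnds κ) (i, i + κ i) = Finset.univ := by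
          ext l
          rw [this]
          simp [h4]
        rw [h5, Fintype.sum_bool]
        simp
    · rw [add_assoc]
      refine Eq.trans (Finset.prod_congr rfl fun j hj => ?_)
        (prod_Ico_add_sub (fun c => t + a c) i _ _)
      have := hrest i.castSucc j (by
        rw [shiftedRowEnds_castSucc]; have := (Finset.mem_Ico.1 hj).1; omega)
      simpa using this

open Classical in
/-- Removing the two largest letters `n'` and `n` from the primed shifted tableaux. -/
theorem generalisedFactorialSchurQ_succ {R : Type*} [CommRing R] {n : ℕ}
    (x y : Fin (n + 1) → R) (a : ℕ → R) {lam : Fin (n + 1) → ℕ} (hlam : StrictAnti lam)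
    (hpos : ∀ i, 0 < lam i) :
    generalisedFactorialSchurQ lam x y a =
      ∑ κ ∈ Fintype.piFinset (fun i : Fin n => Finset.Icc (lam i.succ) (lam i.castSucc)) with
          StrictAnti κ,
        generalisedFactorialSchurQ κ (fun i => x i.castSucc) (fun i => y i.castSucc) a *
        ((x (Fin.last n) + y (Fin.last n)) *
          factorialPower a (x (Fin.last n)) (lam (Fin.last n)) *
          ∏ i : Fin n, ribbonWeight a (x (Fin.last n)) (y (Fin.last n)) (lam i.succ)
            (lam i.castSucc) (κ i)) := by
  have hanti := antitone_val_add_of_strictAnti hlam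
  rw [generalisedFactorialSchurQ_eq_fillingSum,
    fillingSum_rowStrip_split (fun i => Nat.le_add_right _ _) ShiftedRel (shiftedWeight x y a)
      (primedLetterSplit n) NotBeyond shiftedRel_inl_inr
      (fun i j k hjk h => h.1 ⟨rfl, hjk⟩)]
  simp only [shiftedRel_inl, shiftedWeight_inl]
  -- strict interlacing sequences give row ends which decrease weakly
  have hends : ∀ κ : Fin n → ℕ, (∀ i, lam i.succ ≤ κ i) → StrictAnti κ →
      Antitone (shiftedRowEnds κ) := by
    intro κ h1 hκ
    apply antitone_val_add_of_strictAnti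
    cases n with
    | zero => exact fun i j h => absurd (Fin.lt_def.1 h) (by omega)
    | succ n =>
      refine Fin.strictAnti_iff_succ_lt.2 fun i => ?_
      induction i using Fin.lastCases with
      | last =>
        rw [Fin.succ_last, Fin.snoc_last, Fin.snoc_castSucc]
        exact (hpos _).trans_le (h1 _)
      | cast i =>
        rw [Fin.succ_castSucc, Fin.snoc_castSucc, Fin.snoc_castSucc]
        exact hκ (Fin.castSucc_lt_succ (i := i))
  have hinj : Function.Injective (shiftedRowEnds (n := n)) := by
    intro κ κ' h
    funext i
    have := congrFun h i.castSucc
    rw [shiftedRowEnds_castSucc, shiftedRowEnds_castSucc] at this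
    omega
  rw [← Finset.sum_subset (s₁ := Finset.image shiftedRowEnds
    ((Fintype.piFinset fun i : Fin n => Finset.Icc (lam i.succ) (lam i.castSucc)).filter
      StrictAnti)), Finset.sum_image fun _ _ _ _ h => hinj h]
  · refine Finset.sum_congr rfl fun κ hκ => ?_
    simp only [Finset.mem_filter, Fintype.mem_piFinset, Finset.mem_Icc] at hκ
    rw [fillingSum_largest x y a hlam hpos (fun i => (hκ.1 i).1) (fun i => (hκ.1 i).2)
      (hends κ (fun i => (hκ.1 i).1) hκ.2), rowStrip_shiftedRowEnds,
      generalisedFactorialSchurQ_eq_fillingSum]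
  · intro mid hmid
    obtain ⟨κ, hκ, rfl⟩ := Finset.mem_image.1 hmid
    simp only [Finset.mem_filter, Fintype.mem_piFinset, Finset.mem_Icc] at hκ ⊢
    have hA := hends κ (fun i => (hκ.1 i).1) hκ.2
    refine ⟨fun i => ⟨Nat.le_add_right _ _, ?_⟩, ?_⟩
    · induction i using Fin.lastCases with
      | last => rw [shiftedRowEnds_last]; exact Nat.le_add_right _ _
      | cast i =>
        rw [shiftedRowEnds_castSucc]
        exact Nat.add_le_add_left (hκ.1 i).2 _
    · rintro ⟨i, j⟩ hb ⟨i', j'⟩ hc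
      obtain ⟨h1, h2, h3⟩ := mem_rowStrip.1 hb
      obtain ⟨h4, h5, h6⟩ := mem_rowStrip.1 hc
      dsimp only at *
      constructor
      · rintro ⟨rfl, h7⟩
        dsimp only at *
        omega
      · rintro ⟨rfl, h7⟩
        have := hA (show (⟨i', h4⟩ : Fin (n + 1)) ≤ ⟨i, h1⟩ from h7.le)
        dsimp only at *
        omega
  · intro mid hmid hnot
    simp only [Finset.mem_filter, Fintype.mem_piFinset, Finset.mem_Icc] at hmid
    by_contra hne
    obtain ⟨p, hp⟩ := exists_isFilling_of_fillingSum_ne_zero (left_ne_zero_of_mul hne)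
    obtain ⟨q, hq⟩ := exists_isFilling_of_fillingSum_ne_zero (right_ne_zero_of_mul hne)
    obtain ⟨h1, h2, h3⟩ := interlacing_of_isFilling hlam hpos (fun i => (hmid.1 i).1)
      (fun i => (hmid.1 i).2) hmid.2 hp hq
    have h4 : ∀ i : Fin n, (i : ℕ) ≤ mid i.castSucc := fun i => (hmid.1 i.castSucc).1
    refine hnot (Finset.mem_image.2 ⟨fun i => mid i.castSucc - i, ?_, ?_⟩)
    · simp only [Finset.mem_filter, Fintype.mem_piFinset, Finset.mem_Icc]
      refine ⟨fun i => ⟨Nat.le_sub_of_add_le' (h1 i), ?_⟩, ?_⟩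
      · have := (hmid.1 i.castSucc).2
        rw [Fin.val_castSucc] at this
        omega
      · refine strictAnti_of_antitone_val_add fun i j hij => ?_
        have h5 := h3 (Fin.castSucc_le_castSucc_iff.2 hij)
        have := h4 i
        have := h4 j
        dsimp only
        omega
    · funext i
      induction i using Fin.lastCases with
      | last => rw [shiftedRowEnds_last, h2]
      | cast i =>
        rw [shiftedRowEnds_castSucc]
        have := h4 i
        omega

/-- The product of the differences `x_i - x_j` with `i < j`. -/
def differenceProduct {R : Type*} [CommRing R] {n : ℕ} (x : Fin n → R) : R :=
  ∏ i : Fin n, ∏ j ∈ Finset.Ioi i, (x i - x j)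

theorem differenceProduct_succ {R : Type*} [CommRing R] {n : ℕ} (x : Fin (n + 1) → R) :
    differenceProduct x = differenceProduct (fun i => x i.castSucc) *
      ∏ i : Fin n, (x i.castSucc - x (Fin.last n)) :=
  prod_prod_Ioi_castSucc fun i j => x i - x j

/-- The factorial `Q`-function of a strict partition of length `n` in `n` pairs of variables as a
quotient of alternants. -/
theorem differenceProduct_mul_generalisedFactorialSchurQ {R : Type*} [CommRing R] (n : ℕ)
    (x y : Fin n → R) (a : ℕ → R) (lam : Fin n → ℕ) (hlam : StrictAnti lam)
    (hpos : ∀ i, 0 < lam i) :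
    differenceProduct x * generalisedFactorialSchurQ lam x y a =
      (∏ i : Fin n, (x i + y i)) * (∏ i : Fin n, ∏ j ∈ Finset.Ioi i, (x i + y j)) *
        factorialAlternant x a lam := by
  classical
  induction n with
  | zero =>
    rw [generalisedFactorialSchurQ_eq_fillingSum, fillingSum]
    have : rowStrip (fun i : Fin 0 => (i : ℕ)) (fun i => i + lam i) = ∅ := rfl
    rw [this]
    simp [differenceProduct, factorialAlternant, IsFilling]
  | succ n ih =>
    set x' : Fin n → R := fun i => x i.castSucc with hx'
    set y' : Fin n → R := fun i => y i.castSucc with hy'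
    set t := x (Fin.last n) with ht
    set u := y (Fin.last n) with hu
    set I : Fin n → Finset ℕ := fun i => Finset.Icc (lam i.succ) (lam i.castSucc) with hI
    set W : Fin n → ℕ → R := fun i => ribbonWeight a t u (lam i.succ) (lam i.castSucc) with hW
    set P := (∏ i : Fin n, (x' i + y' i)) * ∏ i : Fin n, ∏ j ∈ Finset.Ioi i, (x' i + y' j) with hP
    have hlt : ∀ i : Fin n, lam i.succ < lam i.castSucc :=
      fun i => hlam (Fin.castSucc_lt_succ (i := i))
    have hterm : ∀ κ ∈ (Fintype.piFinset I).filter StrictAnti,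
        differenceProduct x' * generalisedFactorialSchurQ κ x' y' a =
          P * factorialAlternant x' a κ := by
      intro κ hκ
      simp only [Finset.mem_filter, Fintype.mem_piFinset, hI, Finset.mem_Icc] at hκ
      exact ih x' y' κ hκ.2 fun i => (hpos _).trans_le (hκ.1 i).1
    -- interlacing sequences which are not strict have two equal entries
    have hzero : ∀ κ ∈ Fintype.piFinset I, κ ∉ (Fintype.piFinset I).filter StrictAnti →
        (∏ i, W i (κ i)) * factorialAlternant x' a κ = 0 := by
      intro κ hκ hnot
      have hns : ¬ StrictAnti κ := fun h => hnot (Finset.mem_filter.2 ⟨hκ, h⟩)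
      simp only [Fintype.mem_piFinset, hI, Finset.mem_Icc] at hκ
      have hanti : Antitone κ := by
        cases n with
        | zero => exact fun i => i.elim0
        | succ n =>
          refine Fin.antitone_iff_succ_le.2 fun i => ?_
          have h1 := (hκ i.succ).2
          have h2 := (hκ i.castSucc).1
          rw [Fin.succ_castSucc] at h2
          exact h1.trans h2
      have hni : ¬ Function.Injective κ := fun h => hns (hanti.strictAnti_of_injective h)
      rw [Function.not_injective_iff] at hni
      obtain ⟨i, j, hij, hne⟩ := hni
      rw [factorialAlternant_eq_zero x' a hne hij, mul_zero]
    have hdet : (Matrix.of fun i j : Fin n => ∑ k ∈ I i, W i k * factorialPower a (x' j) k).det =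
        (∏ j : Fin n, (x' j + u)) * (Matrix.of fun i j : Fin n =>
          rowSum a (x' j) t (lam i.succ) (lam i.castSucc)).det := by
      rw [← Matrix.det_mul_row]
      congr 1
      ext i j
      exact sum_ribbonWeight a (x' j) t u (hpos _) (hlt i)
    have hsum : differenceProduct x' * generalisedFactorialSchurQ lam x y a =
        (t + u) * factorialPower a t (lam (Fin.last n)) * P * ((∏ j : Fin n, (x' j + u)) *
          (Matrix.of fun i j : Fin n =>
            rowSum a (x' j) t (lam i.succ) (lam i.castSucc)).det) := by
      rw [generalisedFactorialSchurQ_succ x y a hlam hpos, ← hdet, ← sum_mul_factorialAlternant,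
        ← Finset.sum_subset (Finset.filter_subset StrictAnti _) hzero, Finset.mul_sum,
        Finset.mul_sum]
      refine Finset.sum_congr rfl fun κ hκ => ?_
      linear_combination (t + u) * factorialPower a t (lam (Fin.last n)) *
        (∏ i, W i (κ i)) * hterm κ hκ
    rw [differenceProduct_succ, factorialAlternant_succ x a hlam.antitone hpos,
      prod_prod_Ioi_castSucc fun i j => x i + y j, Fin.prod_univ_castSucc]
    linear_combination (∏ i : Fin n, (x' i - t)) * hsum

/-! ### Factorial Schur functions as quotients of alternants -/

/-- The condition that the entries `p`, `q` of a semistandard tableau satisfy in the boxes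
`b`, `c`. -/
def SemistandardRel {n : ℕ} (b c : ℕ × ℕ) (p q : Fin n) : Prop :=
  (b.1 = c.1 → b.2 < c.2 → p ≤ q) ∧ (b.2 = c.2 → b.1 < c.1 → p < q)

/-- The weight of the entry `p` in the box `c` of a semistandard tableau. -/
def semistandardWeight {R : Type*} [CommRing R] {n : ℕ} (x : Fin n → R) (a : ℕ → R) (c : ℕ × ℕ)
    (p : Fin n) : R :=
  x p + a (p + 1 + c.2 - c.1)

theorem factorialSchur_eq_fillingSum {R : Type*} [CommRing R] {n : ℕ} (D : YoungDiagram)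
    (x : Fin n → R) (a : ℕ → R) :
    factorialSchur D x a = fillingSum D.cells SemistandardRel (semistandardWeight x a) := by
  classical
  rw [factorialSchur, fillingSum, ← Finset.sum_filter]
  refine Finset.sum_bij (fun T _ c => ⟨T.1 c.1.1 c.1.2, T.2 c.1 c.2⟩) ?_ ?_ ?_ fun _ _ => rfl
  · intro T _
    refine Finset.mem_filter.2 ⟨Finset.mem_univ _, ?_⟩
    rintro ⟨⟨i, j⟩, hb⟩ ⟨⟨i', j'⟩, hc⟩
    constructor
    · rintro (rfl : i = i') hj
      exact T.1.row_weak hj hc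
    · rintro (rfl : j = j') hi
      exact T.1.col_strict hi hc
  · exact fun T _ T' _ h => BoundedTableau.injective_entries D n h
  · intro p hp
    have hp := (Finset.mem_filter.1 hp).2
    refine ⟨⟨⟨fun i j => if h : (i, j) ∈ D.cells then p ⟨_, h⟩ else 0, ?_, ?_, ?_⟩, ?_⟩,
      Finset.mem_univ _, ?_⟩
    · intro i j k hjk hk
      have hj : (i, j) ∈ D.cells := D.up_left_mem le_rfl hjk.le hk
      replace hk : (i, k) ∈ D.cells := hk
      rw [dif_pos hj, dif_pos hk]
      exact (hp ⟨_, hj⟩ ⟨_, hk⟩).1 rfl hjk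
    · intro i k j hik hk
      have hi : (i, j) ∈ D.cells := D.up_left_mem hik.le le_rfl hk
      replace hk : (k, j) ∈ D.cells := hk
      rw [dif_pos hi, dif_pos hk]
      exact (hp ⟨_, hi⟩ ⟨_, hk⟩).2 rfl hik
    · intro i j h
      exact dif_neg h
    · rintro ⟨i, j⟩ h
      change (if h : (i, j) ∈ D.cells then (p ⟨_, h⟩ : ℕ) else 0) < n
      rw [dif_pos h]
      exact (p _).2
    · funext c
      apply Fin.ext
      exact dif_pos c.2

theorem partitionDiagram_cells {n : ℕ} (μ : Fin n → ℕ) (hμ : Antitone μ) :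
    (partitionDiagram μ hμ).cells = rowStrip (fun _ => 0) μ := by
  ext c
  rw [YoungDiagram.mem_cells, mem_partitionDiagram, mem_rowStrip]
  simp

theorem semistandardRel_inl {n : ℕ} (b c : ℕ × ℕ) (p q : Fin n) :
    SemistandardRel b c (finSumFinEquiv (n := 1) (.inl p)) (finSumFinEquiv (.inl q)) ↔
      SemistandardRel b c p q := Iff.rfl

theorem semistandardRel_inr {n : ℕ} (b c : ℕ × ℕ) (p q : Fin 1) :
    SemistandardRel b c (finSumFinEquiv (m := n) (.inr p)) (finSumFinEquiv (.inr q)) ↔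
      (b.2 = c.2 → ¬ b.1 < c.1) := by
  simp [SemistandardRel, Subsingleton.elim p q]

theorem semistandardRel_inl_inr {n : ℕ} (b c : ℕ × ℕ) (p : Fin n) (q : Fin 1) :
    (SemistandardRel b c (finSumFinEquiv (.inl p)) (finSumFinEquiv (.inr q)) ∧
      SemistandardRel c b (finSumFinEquiv (.inr q)) (finSumFinEquiv (.inl p))) ↔
      NotBeyond b c := by
  have h : finSumFinEquiv (.inl p) < finSumFinEquiv (m := n) (.inr q) := by
    rw [finSumFinEquiv_apply_left, finSumFinEquiv_apply_right, Fin.lt_def]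
    simp only [Fin.val_castAdd, Fin.val_natAdd]
    omega
  simp only [SemistandardRel, h, h.le, h.not_ge, h.not_gt, NotBeyond, implies_true, true_and,
    not_and, imp_false, @eq_comm _ c.1, @eq_comm _ c.2]

/-- In a semistandard tableau of shape `μ` with at most `n + 1` rows, the letters other than the
largest one leave the last row empty, and their row ends `mid` interlace with `μ`. -/
theorem interlacing_of_isFilling_semistandard {n : ℕ} {μ mid : Fin (n + 1) → ℕ}
    (hμ : Antitone μ) (h2 : ∀ i, mid i ≤ μ i)
    (hs : ∀ b ∈ rowStrip (fun _ => 0) mid, ∀ c ∈ rowStrip mid μ, NotBeyond b c)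
    {p : rowStrip (fun _ => 0) mid → Fin n} (hp : IsFilling SemistandardRel p)
    {q : rowStrip mid μ → Fin 1}
    (hq : IsFilling (fun b c l m => SemistandardRel b c (finSumFinEquiv (m := n) (.inr l))
      (finSumFinEquiv (.inr m))) q) :
    (∀ i : Fin n, μ i.succ ≤ mid i.castSucc) ∧ mid (Fin.last n) = 0 := by
  have hdown : ∀ (i j : Fin (n + 1)) (k : ℕ), i < j → mid i ≤ k → k < μ i → mid j ≤ k := by
    intro i j k hij hik hk
    by_contra! hkj
    exact (hs (j, k) (mk_mem_rowStrip.2 ⟨Nat.zero_le _, hkj⟩) (i, k)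
      (mk_mem_rowStrip.2 ⟨hik, hk⟩)).2 ⟨rfl, hij⟩
  constructor
  · intro i
    by_contra! h
    have hi : i.castSucc < i.succ := Fin.castSucc_lt_succ
    have h3 := h.trans_le (hμ hi.le)
    have m1 : (((i.castSucc : Fin (n + 1)) : ℕ), mid i.castSucc) ∈ rowStrip mid μ :=
      mk_mem_rowStrip.2 ⟨le_rfl, h3⟩
    have m2 : (((i.succ : Fin (n + 1)) : ℕ), mid i.castSucc) ∈ rowStrip mid μ :=
      mk_mem_rowStrip.2 ⟨hdown _ _ _ hi le_rfl h3, h⟩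
    exact (semistandardRel_inr _ _ _ _).1 (hq ⟨_, m1⟩ ⟨_, m2⟩) rfl hi
  · by_contra hn
    have hpos : ∀ i, 0 < mid i := by
      intro i
      rcases (Fin.le_last i).eq_or_lt with rfl | hi
      · exact Nat.pos_of_ne_zero hn
      by_contra! h
      have := hdown i _ 0 hi h (by have := h2 (Fin.last n); have := hμ hi.le; omega)
      omega
    have hm : ∀ i ≤ n, (i, 0) ∈ rowStrip (fun _ => 0) mid := fun i hi =>
      (mk_mem_rowStrip (i := ⟨i, Nat.lt_succ_of_le hi⟩)).2 ⟨le_rfl, hpos _⟩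
    -- column strictness of the first column
    have hd : ∀ i (hi : i ≤ n), i ≤ (p ⟨_, hm i hi⟩ : ℕ) := by
      intro i
      induction i with
      | zero => exact fun _ => Nat.zero_le _
      | succ i ih =>
        intro hi
        have h3 := ih (by omega)
        have h4 : (p _ : ℕ) < p _ :=
          (hp ⟨_, hm i (by omega)⟩ ⟨_, hm (i + 1) hi⟩).2 rfl (Nat.lt_succ_self i)
        omega
    have := hd n le_rfl
    have := (p ⟨_, hm n le_rfl⟩).2
    omega

/-- Removing the largest letter from the semistandard tableaux. -/
theorem fillingSum_semistandard_succ {R : Type*} [CommRing R] {n : ℕ}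
    (x : Fin (n + 1) → R) (a : ℕ → R) {μ : Fin (n + 1) → ℕ} (hμ : Antitone μ) :
    fillingSum (rowStrip (fun _ => 0) μ) SemistandardRel (semistandardWeight x a) =
      ∑ ν ∈ Fintype.piFinset (fun i : Fin n => Finset.Icc (μ i.succ) (μ i.castSucc)),
        fillingSum (rowStrip (fun _ => 0) ν) SemistandardRel
          (semistandardWeight (fun i => x i.castSucc) a) *
        ((∏ i : Fin n, ∏ c ∈ Finset.Ico (ν i + staircase n i + 1)
            (μ i.castSucc + staircase (n + 1) i.castSucc), (x (Fin.last n) + a c)) *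
          factorialPower a (x (Fin.last n)) (μ (Fin.last n) + staircase (n + 1) (Fin.last n))) := by
  set t := x (Fin.last n) with ht
  let ext (ν : Fin n → ℕ) : Fin (n + 1) → ℕ := Fin.snoc (α := fun _ => ℕ) ν 0
  have hext1 : ∀ ν i, ext ν i.castSucc = ν i := fun ν i => by simp [ext]
  have hext2 : ∀ ν, ext ν (Fin.last n) = 0 := fun ν => by simp [ext]
  have hinj : Function.Injective ext := by
    intro ν ν' h
    funext i
    rw [← hext1 ν, h, hext1]
  have hstrip : ∀ ν, rowStrip (fun _ => 0) (ext ν) = rowStrip (fun _ => 0) ν := by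
    intro ν
    rw [rowStrip_eq_of_castSucc (hext2 ν).le]
    simp only [hext1]
  have hw : ∀ (c : ℕ × ℕ) (p : Fin n),
      semistandardWeight x a c (finSumFinEquiv (n := 1) (.inl p)) =
        semistandardWeight (fun i => x i.castSucc) a c p := fun c p => rfl
  have hw' : ∀ (c : ℕ × ℕ) (p : Fin 1),
      semistandardWeight x a c (finSumFinEquiv (m := n) (.inr p)) = t + a (n + 1 + c.2 - c.1) := by
    intro c p
    obtain rfl := Subsingleton.elim p 0
    rfl
  rw [fillingSum_rowStrip_split (fun i => Nat.zero_le _) SemistandardRel (semistandardWeight x a)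
    (finSumFinEquiv (m := n) (n := 1)) NotBeyond semistandardRel_inl_inr
    (fun i j k hjk h => h.1 ⟨rfl, hjk⟩)]
  simp only [semistandardRel_inl, hw, hw']
  rw [← Finset.sum_subset (s₁ := Finset.image ext
    (Fintype.piFinset fun i : Fin n => Finset.Icc (μ i.succ) (μ i.castSucc))),
    Finset.sum_image fun _ _ _ _ h => hinj h]
  · refine Finset.sum_congr rfl fun ν hν => ?_
    simp only [Fintype.mem_piFinset, Finset.mem_Icc] at hν
    rw [hstrip, fillingSum_eq_prod (D := rowStrip (ext ν) μ) (fun _ => Finset.univ), prod_rowStrip,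
      Fin.prod_univ_castSucc]
    · simp only [Finset.univ_unique, Finset.sum_singleton, hext1, hext2]
      congr 2
      · refine Finset.prod_congr rfl fun i _ => ?_
        have h1 : ν i + staircase n i + 1 = ν i + (n + 1 - i) := by
          simp only [staircase]; omega
        have h2 : staircase (n + 1) i.castSucc = n + 1 - i := rfl
        rw [h1, h2, ← Finset.prod_Ico_add']
        refine Finset.prod_congr rfl fun j _ => ?_
        rw [Fin.val_castSucc, show n + 1 + j - (i : ℕ) = j + (n + 1 - i) by omega]
      · have h2 : staircase (n + 1) (Fin.last n) = 1 := by simp [staircase]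
        rw [factorialPower, h2, ← Finset.prod_Ico_add' _ 0 _ 1]
        refine Finset.prod_congr rfl fun j _ => ?_
        rw [Fin.val_last, show n + 1 + j - n = j + 1 by omega]
    · intro q
      simp only [Finset.mem_univ, implies_true, iff_true]
      rintro ⟨⟨i, j⟩, hb⟩ ⟨⟨i', j'⟩, hc⟩
      rw [semistandardRel_inr]
      rintro (rfl : j = j') (hi : i < i')
      obtain ⟨h1, h2, h3⟩ := mem_rowStrip.1 hb
      obtain ⟨h4, h5, h6⟩ := mem_rowStrip.1 hc
      dsimp only at *
      have h7 : i < n := by omega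
      have h8 : ext ν ⟨i, h1⟩ = ν ⟨i, h7⟩ := hext1 ν ⟨i, h7⟩
      have h9 := (hν ⟨i, h7⟩).1
      have h10 := hμ (show (⟨i, h7⟩ : Fin n).succ ≤ ⟨i', h4⟩ from hi)
      omega
  · intro mid hmid
    obtain ⟨ν, hν, rfl⟩ := Finset.mem_image.1 hmid
    simp only [Finset.mem_filter, Fintype.mem_piFinset, Finset.mem_Icc] at hν ⊢
    have hA : Antitone (ext ν) := by
      cases n with
      | zero =>
        intro i j _
        rw [show i = j from Fin.ext (by omega)]
      | succ n =>
        refine Fin.antitone_iff_succ_le.2 fun i => ?_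
        induction i using Fin.lastCases with
        | last =>
          rw [Fin.succ_last, hext2]
          exact Nat.zero_le _
        | cast i =>
          rw [Fin.succ_castSucc, hext1, hext1]
          exact (hν i.succ).2.trans (hν i.castSucc).1
    refine ⟨fun i => ⟨Nat.zero_le _, ?_⟩, ?_⟩
    · induction i using Fin.lastCases with
      | last => rw [hext2]; exact Nat.zero_le _
      | cast i => rw [hext1]; exact (hν i).2
    · rintro ⟨i, j⟩ hb ⟨i', j'⟩ hc
      obtain ⟨h1, h2, h3⟩ := mem_rowStrip.1 hb
      obtain ⟨h4, h5, h6⟩ := mem_rowStrip.1 hc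
      dsimp only at *
      constructor
      · rintro ⟨rfl, h7⟩
        dsimp only at *
        omega
      · rintro ⟨rfl, h7⟩
        have := hA (show (⟨i', h4⟩ : Fin (n + 1)) ≤ ⟨i, h1⟩ from h7.le)
        dsimp only at *
        omega
  · intro mid hmid hnot
    simp only [Finset.mem_filter, Fintype.mem_piFinset, Finset.mem_Icc] at hmid
    by_contra hne
    obtain ⟨p, hp⟩ := exists_isFilling_of_fillingSum_ne_zero (left_ne_zero_of_mul hne)
    obtain ⟨q, hq⟩ := exists_isFilling_of_fillingSum_ne_zero (right_ne_zero_of_mul hne)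
    obtain ⟨h1, h2⟩ := interlacing_of_isFilling_semistandard hμ (fun i => (hmid.1 i).2) hmid.2
      hp hq
    refine hnot (Finset.mem_image.2 ⟨fun i => mid i.castSucc, ?_, ?_⟩)
    · simp only [Fintype.mem_piFinset, Finset.mem_Icc]
      exact fun i => ⟨h1 i, (hmid.1 i.castSucc).2⟩
    · funext i
      induction i using Fin.lastCases with
      | last => rw [hext2, h2]
      | cast i => rw [hext1]

theorem strictAnti_add_staircase {n : ℕ} {μ : Fin n → ℕ} (hμ : Antitone μ) :
    StrictAnti (μ + staircase n) := by
  intro i j hij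
  have h1 := hμ hij.le
  have h2 : (i : ℕ) < j := hij
  simp only [Pi.add_apply, staircase]
  omega

theorem add_staircase_pos {n : ℕ} (μ : Fin n → ℕ) (i : Fin n) : 0 < (μ + staircase n) i := by
  simp only [Pi.add_apply, staircase]
  omega

/-- The bialternant formula for factorial Schur functions. -/
theorem differenceProduct_mul_fillingSum_semistandard {R : Type*} [CommRing R] (n : ℕ)
    (x : Fin n → R) (a : ℕ → R) (μ : Fin n → ℕ) (hμ : Antitone μ) :
    differenceProduct x *
        fillingSum (rowStrip (fun _ => 0) μ) SemistandardRel (semistandardWeight x a) =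
      factorialAlternant x a (μ + staircase n) := by
  induction n with
  | zero =>
    rw [fillingSum]
    have : rowStrip (fun _ => 0) μ = ∅ := rfl
    rw [this]
    simp [differenceProduct, factorialAlternant, IsFilling]
  | succ n ih =>
    set x' : Fin n → R := fun i => x i.castSucc with hx'
    set t := x (Fin.last n) with ht
    set lam := μ + staircase (n + 1) with hlam
    rw [differenceProduct_succ, factorialAlternant_succ x a (strictAnti_add_staircase hμ).antitone
      (add_staircase_pos μ), fillingSum_semistandard_succ x a hμ]
    have hdet := sum_mul_factorialAlternant x' a
      (fun i : Fin n => Finset.Ico (lam i.succ) (lam i.castSucc))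
      (fun i k => ∏ c ∈ Finset.Ico (k + 1) (lam i.castSucc), (t + a c))
    -- shifting by the staircase turns weak interlacing of partitions into half-open intervals
    have hshift : ∑ κ ∈ Fintype.piFinset
          (fun i : Fin n => Finset.Ico (lam i.succ) (lam i.castSucc)),
          (∏ i, ∏ c ∈ Finset.Ico (κ i + 1) (lam i.castSucc), (t + a c)) *
            factorialAlternant x' a κ =
        ∑ ν ∈ Fintype.piFinset (fun i : Fin n => Finset.Icc (μ i.succ) (μ i.castSucc)),
          (∏ i : Fin n, ∏ c ∈ Finset.Ico (ν i + staircase n i + 1) (lam i.castSucc), (t + a c)) *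
            factorialAlternant x' a (ν + staircase n) := by
      have h1 : ∀ i : Fin n, lam i.succ = μ i.succ + staircase n i := fun i => by
        simp [hlam, staircase]
      have h2 : ∀ i : Fin n, lam i.castSucc = μ i.castSucc + staircase n i + 1 := fun i => by
        simp only [hlam, staircase, Pi.add_apply, Fin.val_castSucc]
        omega
      symm
      refine Finset.sum_bij (fun ν _ => ν + staircase n) ?_ ?_ ?_ fun _ _ => rfl
      · intro ν hν
        simp only [Fintype.mem_piFinset, Finset.mem_Icc, Finset.mem_Ico, Pi.add_apply, h1, h2]
          at hν ⊢
        exact fun i => ⟨Nat.add_le_add_right (hν i).1 _, by have := (hν i).2; omega⟩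
      · exact fun ν _ ν' _ h => add_right_cancel h
      · intro κ hκ
        simp only [Fintype.mem_piFinset, Finset.mem_Ico, h1, h2] at hκ
        refine ⟨κ - staircase n, ?_, funext fun i => ?_⟩
        · simp only [Fintype.mem_piFinset, Finset.mem_Icc, Pi.sub_apply]
          exact fun i => by have := hκ i; omega
        · have := hκ i
          simp only [Pi.add_apply, Pi.sub_apply]
          omega
    have hrow : (Matrix.of fun i j : Fin n =>
        ∑ k ∈ Finset.Ico (lam i.succ) (lam i.castSucc),
          (∏ c ∈ Finset.Ico (k + 1) (lam i.castSucc), (t + a c)) * factorialPower a (x' j) k) =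
        Matrix.of fun i j : Fin n => rowSum a (x' j) t (lam i.succ) (lam i.castSucc) := rfl
    rw [hshift, hrow] at hdet
    rw [← hdet, Finset.mul_sum, Finset.mul_sum]
    refine Finset.sum_congr rfl fun ν hν => ?_
    simp only [Fintype.mem_piFinset, Finset.mem_Icc] at hν
    have hanti : Antitone ν := by
      cases n with
      | zero => exact fun i => i.elim0
      | succ n =>
        refine Fin.antitone_iff_succ_le.2 fun i => ?_
        have h1 := (hν i.succ).2
        have h2 := (hν i.castSucc).1
        rw [Fin.succ_castSucc] at h2
        exact h1.trans h2
    rw [← ih x' ν hanti]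
    simp only [hlam, Pi.add_apply]
    ring

/-! ### The factorisation -/

theorem map_factorialSchur {R S : Type*} [CommRing R] [CommRing S] (f : R →+* S) {n : ℕ}
    (D : YoungDiagram) (x : Fin n → R) (a : ℕ → R) :
    f (factorialSchur D x a) = factorialSchur D (fun i => f (x i)) fun c => f (a c) := by
  simp [factorialSchur]

theorem map_generalisedFactorialSchurQ {R S : Type*} [CommRing R] [CommRing S] (f : R →+* S)
    {n : ℕ} (lam : Fin n → ℕ) (x y : Fin n → R) (a : ℕ → R) :
    f (generalisedFactorialSchurQ lam x y a) =
      generalisedFactorialSchurQ lam (fun i => f (x i)) (fun i => f (y i)) fun c => f (a c) := by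
  simp only [generalisedFactorialSchurQ, map_sum, map_prod, apply_ite f, map_sub, map_add]

/-- The factorisation of the generalised factorial `Q`-function. The two bialternant formulas give
it up to the factor `∏_{i<j} (x_i - x_j)`, which can be cancelled for independent variables. -/
theorem generalisedFactorialSchurQ_add_staircase {R : Type*} [CommRing R] {n : ℕ} {μ : Fin n → ℕ}
    (hμ : Antitone μ) (x y : Fin n → R) (a : ℕ → R) :
    generalisedFactorialSchurQ (μ + staircase n) x y a =
      (∏ i : Fin n, (x i + y i)) * (∏ i : Fin n, ∏ j ∈ Finset.Ioi i, (x i + y j)) *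
        factorialSchur (partitionDiagram μ hμ) x a := by
  let X : Fin n → MvPolynomial ((Fin n ⊕ Fin n) ⊕ ℕ) ℤ := fun i => .X (.inl (.inl i))
  let Y : Fin n → MvPolynomial ((Fin n ⊕ Fin n) ⊕ ℕ) ℤ := fun i => .X (.inl (.inr i))
  let A : ℕ → MvPolynomial ((Fin n ⊕ Fin n) ⊕ ℕ) ℤ := fun c => .X (.inr c)
  have hne : differenceProduct X ≠ 0 := by
    refine Finset.prod_ne_zero_iff.2 fun i _ => Finset.prod_ne_zero_iff.2 fun j hj => ?_
    intro h
    have h1 := MvPolynomial.X_injective (sub_eq_zero.1 h)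
    exact (Finset.mem_Ioi.1 hj).ne (Sum.inl.inj (Sum.inl.inj h1))
  have huniv : generalisedFactorialSchurQ (μ + staircase n) X Y A =
      (∏ i : Fin n, (X i + Y i)) * (∏ i : Fin n, ∏ j ∈ Finset.Ioi i, (X i + Y j)) *
        factorialSchur (partitionDiagram μ hμ) X A := by
    apply mul_left_cancel₀ hne
    have h1 := differenceProduct_mul_generalisedFactorialSchurQ n X Y A (μ + staircase n)
      (strictAnti_add_staircase hμ) (add_staircase_pos μ)
    have h2 := differenceProduct_mul_fillingSum_semistandard n X A μ hμ
    rw [factorialSchur_eq_fillingSum, partitionDiagram_cells, h1, ← h2]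
    ring
  let f : MvPolynomial ((Fin n ⊕ Fin n) ⊕ ℕ) ℤ →+* R :=
    MvPolynomial.eval₂Hom (Int.castRingHom R) (Sum.elim (Sum.elim x y) a)
  have h := congrArg f huniv
  simpa only [map_generalisedFactorialSchurQ, map_factorialSchur, map_mul, map_prod, map_add,
    f, X, Y, A, MvPolynomial.eval₂Hom_X', Sum.elim_inl, Sum.elim_inr] using h

theorem mainTheorem2 {R : Type*} [CommRing R] (n : ℕ) (μ : Fin n → ℕ) (hμ : Antitone μ)
    (x : Fin n → R) (a : ℕ → R) :
    (StrictAnti (μ + staircase n) ∧ ∀ i, 0 < (μ + staircase n) i) ∧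
    factorialSchurQ (μ + staircase n) x a =
      (∏ i : Fin n, 2 * x i) * (∏ i : Fin n, ∏ j ∈ Finset.Ioi i, (x i + x j)) *
        factorialSchur (partitionDiagram μ hμ) x a := by
  refine ⟨⟨strictAnti_add_staircase hμ, add_staircase_pos μ⟩, ?_⟩
  rw [factorialSchurQ, generalisedFactorialSchurQ_add_staircase hμ]
  simp only [two_mul]
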